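/- Let $d\ge 1$ be odd and $f(z)=z^{d+1}$, as a germ of a holomorphic function $(\mathbb C,0)\to(\mathbb C,0)$. A deformation of $f$ is a germ of a holomorphic function $F:(\mathbb C\times\mathbb C^k,0)\to(\mathbb C,0)$, $F(z,\lambda)=f_\lambda(z)$, with $f_0=f$; it is versal if every deformation $G(z,s)$ of $f$, with any number of parameters, has the form $G(z,s)=F(g(z,s),\theta(s))$ with germs of holomorphic maps $g,\theta$ such that $g(z,0)=z$, $\theta(0)=0$. The pure Stokes' set of $F$ is the germ at $0\in\mathbb C^k$ of the closure of the set of all $\lambda$ such that $f_\lambda$ has four different critical values $\alpha,\alpha',\beta,\beta'$, at critical points close to the origin in $\mathbb C$, satisfying $\alpha+\alpha'=\beta+\beta'$. The local multiplicity at $0$ of a (possibly empty) hypersurface germ in $\mathbb C^k$ is the order at $0$ of its reduced equation, that is, of a holomorphic function which vanishes exactly on the hypersurface and has a simple zero at its generic points; the order of a function is the order of the zero at $0$ of its restriction to a generic line through $0$. Then, for every versal deformation of $f$, and in particular for the deformation $z^{d+1}+\lambda_{d-1}z^{d-1}+\dots+\lambda_1z+\lambda_0$, the pure Stokes' set is a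 (possibly empty) hypersurface germ whose local multiplicity at $0$ is equal to $$\frac{(d+1)(d-1)(d-2)(d-3)}{8}.$$ -/

import Mathlib

open Filter Topology

/-- `F` represents a germ at the origin of a holomorphic deformation, with parameter space `ℂ^k`,
of the germ at `0` of the function `f` of one complex variable. -/
structure IsDeformation (f : ℂ → ℂ) {k : ℕ} (F : ℂ × (Fin k → ℂ) → ℂ) : Prop where
  analyticAt : AnalyticAt ℂ F (0, 0)
  base_eq : ∀ᶠ z in 𝓝 (0 : ℂ), F (z, 0) = f z

/-- A deformation `F` of `f` is versal if every deformation `G` of `f`, with any number `l` of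
parameters, is (right) equivalent to a deformation induced from `F`: as germs at the origin,
`G (z, s) = F (g (z, s), θ s)` with holomorphic `g` and `θ` such that `g (z, 0) = z`, `θ 0 = 0`. -/
structure IsVersalDeformation (f : ℂ → ℂ) {k : ℕ} (F : ℂ × (Fin k → ℂ) → ℂ) : Prop where
  isDeformation : IsDeformation f F
  versal : ∀ (l : ℕ) (G : ℂ × (Fin l → ℂ) → ℂ), IsDeformation f G →
    ∃ (g : ℂ × (Fin l → ℂ) → ℂ) (θ : (Fin l → ℂ) → (Fin k → ℂ)),
      AnalyticAt ℂ g (0, 0) ∧ AnalyticAt ℂ θ 0 ∧ θ 0 = 0 ∧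
      (∀ᶠ z in 𝓝 (0 : ℂ), g (z, 0) = z) ∧
      ∀ᶠ p in 𝓝 ((0, 0) : ℂ × (Fin l → ℂ)), G p = F (g p, θ p.2)

/-- The pure Stokes' set of the family `F`, where only the critical points in the disc of radius
`r` about the origin are taken into account: the closure of the set of all parameter values `lam`
such that the function `F (·, lam)` has four different critical values `α, α', β, β'`
(at critical points of this disc) with `α + α' = β + β'`. -/
def pureStokesSet {k : ℕ} (F : ℂ × (Fin k → ℂ) → ℂ) (r : ℝ) : Set (Fin k → ℂ) :=
  closure {lam | ∃ z : Fin 4 → ℂ,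
    (∀ i, z i ∈ Metric.ball (0 : ℂ) r ∧ deriv (fun w => F (w, lam)) (z i) = 0) ∧
    Function.Injective (fun i => F (z i, lam)) ∧
    F (z 0, lam) + F (z 1, lam) = F (z 2, lam) + F (z 3, lam)}

/-- `h` is a reduced local equation of the set `X ⊆ ℂ^k` at the origin: it is holomorphic, near
the origin it vanishes exactly on `X`, and it vanishes with multiplicity one at generic
points of `X` (the points where `h = 0` and `dh ≠ 0` are dense in the zero set). -/
structure IsReducedLocalEquation {k : ℕ} (h : (Fin k → ℂ) → ℂ) (X : Set (Fin k → ℂ)) : Prop where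
  analyticAt : AnalyticAt ℂ h 0
  mem_iff : ∀ᶠ x in 𝓝 (0 : Fin k → ℂ), x ∈ X ↔ h x = 0
  reduced : ∀ᶠ x in 𝓝 (0 : Fin k → ℂ), h x = 0 →
    x ∈ closure {y | h y = 0 ∧ fderiv ℂ h y ≠ 0}

/-- The degree (order of vanishing) at the origin of a holomorphic function: the order
at `0` of its restriction to a generic line through the origin, that is, the minimal one
of the orders of its restrictions to such lines. -/
noncomputable def degreeAtZero {k : ℕ} (h : (Fin k → ℂ) → ℂ) : ℕ∞ :=
  ⨅ v : Fin k → ℂ, analyticOrderAt (fun t : ℂ => h (t • v)) 0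

/-- The (possibly empty) set `X` is, near the origin of `ℂ^k`, an analytic hypersurface, whose
local multiplicity at the origin is equal to `m`. -/
def HasLocalMultiplicity {k : ℕ} (X : Set (Fin k → ℂ)) (m : ℕ) : Prop :=
  ∃ h : (Fin k → ℂ) → ℂ, IsReducedLocalEquation h X ∧ degreeAtZero h = m

/-- The local multiplicity at `0` of the (germ of the) pure Stokes' set of the deformation
germ `F` is `m`; only critical points close to the origin count, so the
disc containing them is any sufficiently small one. -/
def HasPureStokesMultiplicity {k : ℕ} (F : ℂ × (Fin k → ℂ) → ℂ) (m : ℕ) : Prop :=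
  ∀ᶠ r in 𝓝[>] (0 : ℝ), HasLocalMultiplicity (pureStokesSet F r) m

/-- The monomial deformation `z^{d+1} + λ_{d-1} z^{d-1} + ⋯ + λ_1 z + λ_0` of `z^{d+1}`. -/
def monomialDeformation (d : ℕ) : ℂ × (Fin d → ℂ) → ℂ :=
  fun p => p.1 ^ (d + 1) + ∑ i : Fin d, p.2 i * p.1 ^ (i : ℕ)

/-!
Write `f_λ` for the members of the monomial deformation and `α_j` for their critical values. The
equation of the pure Stokes' set is `h = ∏ (α_a + α_b - α_c - α_e)`, one factor for every pair of
disjoint pairs of critical points. Up to a constant it is `stokesProduct` of the critical values; as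
a symmetric polynomial in the critical points, it is a polynomial in `λ` (`stokesEquation`).

*Multiplicity.* With the weight `d + 1 - i` of `λ_i`, the polynomial `h` is quasihomogeneous of weight
`3 (d choose 4) (d + 1)`, and it does not depend on `λ_0`. The largest remaining weight is `d`, of
`λ_1`, so the order of `h` at `0` is at least `m = 3 (d choose 4) (d + 1) / d`. It is equal to `m`,
because `h` does not vanish at `z^{d+1} + z`: there, the critical values are proportional to
the `d`-th roots of `-1`, and for odd `d` two different pairs of these have different sums
(`stokesEquation_ne_zero`, `degreeAtZero_comp`).

*Reducedness.* Where all the critical points are distinct, the critical values are local coordinates on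
the parameter space (`injective_fderiv_criticalMap`), and `h` is a product of pairwise
non-proportional linear forms in these coordinates; so at generic points of its zero set `h` has a
simple zero and the critical values are distinct. No component of the zero set consists of parameters
with multiple critical points: as a function of the critical points, no factor of `h` vanishes
identically on a hyperplane `z_i = z_j` (`exists_eq_and_stokesForm_ne_zero`), and
`zeros_subset_closure_diff_hyperplanes` applies.

*Versal deformations.* The map `(g, λ) ↦ f_λ ∘ g` on the disc algebra is a polynomial, and its derivative at
`(id, 0)` is invertible by division by `z^d`. The inverse function theorem shows that every
deformation `F` of `z^{d+1}` is induced from the monomial one by a map `θ` of the parameters, and that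
`θ ∘ θ' = id` if the monomial deformation is also induced from `F` by `θ'`. Hence `θ` is a submersion if
`F` is versal, the pure Stokes' set of `F` is the preimage of that of the monomial deformation, and
`h ∘ θ` is its reduced equation, with the same order at `0`.
-/

/-! ### Zeros and orders of holomorphic functions -/

/-- If a holomorphic function is smaller at the centre of a disc than on its boundary, it has a zero in
the disc: otherwise its inverse would violate the maximum principle. -/
theorem exists_zero_of_norm_lt_on_sphere {φ : ℂ → ℂ} {ρ m : ℝ} (hρ : 0 < ρ)
    (hφ : DiffContOnCl ℂ φ (Metric.ball 0 ρ)) (h0 : ‖φ 0‖ < m)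
    (hm : ∀ z ∈ Metric.sphere (0 : ℂ) ρ, m ≤ ‖φ z‖) :
    ∃ z ∈ Metric.ball (0 : ℂ) ρ, φ z = 0 := by
  by_contra! hne
  have hmpos : 0 < m := (norm_nonneg _).trans_lt h0
  have hcl : ∀ z ∈ closure (Metric.ball (0 : ℂ) ρ), φ z ≠ 0 := by
    intro z hz hz0
    rw [closure_ball _ hρ.ne'] at hz
    rcases (Metric.mem_closedBall.1 hz).lt_or_eq with h | h
    · exact hne z h hz0
    · have := hm z h
      rw [hz0, norm_zero] at this
      linarith
  have hinv : DiffContOnCl ℂ (fun z => (φ z)⁻¹) (Metric.ball 0 ρ) := hφ.inv hcl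
  have hmem : (0 : ℂ) ∈ closure (Metric.ball (0 : ℂ) ρ) :=
    subset_closure (Metric.mem_ball_self hρ)
  have := Complex.norm_le_of_forall_mem_frontier_norm_le (C := m⁻¹) Metric.isBounded_ball hinv
    (fun z hz => by
      rw [frontier_ball _ hρ.ne'] at hz
      rw [norm_inv]
      exact inv_anti₀ hmpos (hm z hz)) hmem
  rw [norm_inv] at this
  have h00 : 0 < ‖φ 0‖ := norm_pos_iff.2 (hcl 0 hmem)
  have := (inv_le_inv₀ h00 hmpos).1 this
  linarith

theorem isOpen_ne_zero_of_continuous {E : Type*} [TopologicalSpace E] {P : E → ℂ}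
    (hP : Continuous P) : IsOpen {y | P y ≠ 0} :=
  isOpen_ne_fun hP continuous_const

section
variable {E : Type*} [NormedAddCommGroup E] [NormedSpace ℂ E]

theorem dense_ne_zero_of_analyticOnNhd {P : E → ℂ}
    (hP : AnalyticOnNhd ℂ P Set.univ) {x : E} (hx : P x ≠ 0) : Dense {y | P y ≠ 0} := by
  intro y
  by_contra hy
  have h1 : ∀ᶠ w in 𝓝 y, P w = 0 := by
    rw [mem_closure_iff_frequently, not_frequently] at hy
    filter_upwards [hy] with w hw
    simpa using hw
  exact hx (hP.eqOn_zero_of_preconnected_of_eventuallyEq_zero isPreconnected_univ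
    (Set.mem_univ y) h1 (Set.mem_univ x))

/-- If an entire function `P` vanishes identically on none of finitely many hyperplanes `ker (ℓ i)`,
then the zero set of `P` has no local component inside their union. Restrict `P` to the lines parallel
to a transversal vector `v`. A line through a point `y` near `z` carries a zero of `P` near `z`; if
all these zeros lay on the hyperplanes, the projection of `y` along `v` to one of the hyperplanes
would be a zero of `P` for every `y` near `z`, while the `y` for which it is not are dense. -/
theorem zeros_subset_closure_diff_hyperplanes [CompleteSpace E] {ι : Type*} [Finite ι]
    {P : E → ℂ} (hP : AnalyticOnNhd ℂ P Set.univ) {w₀ : E} (hw₀ : P w₀ ≠ 0)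
    (ℓ : ι → E →L[ℂ] ℂ)
    (hℓ : ∀ i, ℓ i ≠ 0) (hPℓ : ∀ i, ∃ x, ℓ i x = 0 ∧ P x ≠ 0) {z : E} (hz : P z = 0) :
    z ∈ closure {y | P y = 0 ∧ ∀ i, ℓ i y ≠ 0} := by
  have hPc : Continuous P := continuousOn_univ.1 hP.continuousOn
  rw [Metric.mem_closure_iff]
  intro ε hε
  by_contra! hcon
  -- The direction `w - z` is transversal to all the hyperplanes, and `P` does not vanish
  -- identically on the line through `z` in this direction.
  obtain ⟨w, hPw, hℓw⟩ : ∃ w, P w ≠ 0 ∧ ∀ i, ℓ i (w - z) ≠ 0 := by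
    have h3 : Dense (⋂ i, {y | ℓ i (y - z) ≠ 0}) := by
      refine dense_iInter_of_isOpen (fun i => isOpen_ne_zero_of_continuous (by fun_prop))
        fun i => ?_
      obtain ⟨u, hu⟩ : ∃ u, ℓ i u ≠ 0 := by
        by_contra! h
        exact hℓ i (ContinuousLinearMap.ext h)
      refine dense_ne_zero_of_analyticOnNhd (x := u + z) (fun y _ => ?_) (by simpa using hu)
      exact ((ℓ i).analyticAt _).comp (analyticAt_id.sub analyticAt_const)
    obtain ⟨w, hw⟩ := h3.inter_open_nonempty _ (isOpen_ne_zero_of_continuous hPc) ⟨w₀, hw₀⟩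
    exact ⟨w, hw.1, fun i => Set.mem_iInter.1 hw.2 i⟩
  set v := w - z with hv
  have hline : ∀ y : E, AnalyticOnNhd ℂ (fun t : ℂ => P (y + t • v)) Set.univ := fun y t _ =>
    (hP _ (Set.mem_univ _)).comp
      (analyticAt_const.add ((analyticAt_id).smul analyticAt_const))
  have hk : ∀ᶠ t in 𝓝[≠] (0 : ℂ), P (z + t • v) ≠ 0 := by
    rcases (hline z 0 (Set.mem_univ _)).eventually_eq_zero_or_eventually_ne_zero with h | h
    · have := (hline z).eqOn_zero_of_preconnected_of_eventuallyEq_zero isPreconnected_univ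
        (Set.mem_univ 0) h (Set.mem_univ 1)
      simp [hv, hPw] at this
    · exact h
  obtain ⟨ρ, hρ, hρv, hρk⟩ : ∃ ρ : ℝ, 0 < ρ ∧ ρ * ‖v‖ < ε / 2 ∧
      ∀ t ∈ Metric.sphere (0 : ℂ) ρ, P (z + t • v) ≠ 0 := by
    rw [eventually_nhdsWithin_iff, Metric.eventually_nhds_iff] at hk
    obtain ⟨δ, hδ, hk⟩ := hk
    have h1 : ∀ᶠ ρ in 𝓝[>] (0 : ℝ), ρ * ‖v‖ < ε / 2 := by
      have : Tendsto (fun ρ : ℝ => ρ * ‖v‖) (𝓝[>] 0) (𝓝 (0 * ‖v‖)) :=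
        ((continuous_id.mul continuous_const).tendsto _).mono_left nhdsWithin_le_nhds
      rw [zero_mul] at this
      exact this.eventually_lt_const (half_pos hε)
    have h2 : ∀ᶠ ρ in 𝓝[>] (0 : ℝ), ρ < δ :=
      nhdsWithin_le_nhds (eventually_lt_nhds hδ)
    obtain ⟨ρ, h1, h2, h3⟩ := (h1.and (h2.and self_mem_nhdsWithin)).exists
    refine ⟨ρ, h3, h1, fun t ht => hk ?_ ?_⟩
    · rw [Metric.mem_sphere.1 ht]; exact h2
    · rintro rfl
      rw [Metric.mem_sphere, dist_self] at ht
      exact (ne_of_gt h3) ht.symm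
  have hsph : IsCompact (Metric.sphere (0 : ℂ) ρ) := isCompact_sphere _ _
  obtain ⟨t₀, ht₀, hmin⟩ := hsph.exists_isMinOn
    (NormedSpace.sphere_nonempty.2 hρ.le)
    (f := fun t => ‖P (z + t • v)‖) (by fun_prop)
  set m := ‖P (z + t₀ • v)‖ with hm
  have hmpos : 0 < m := norm_pos_iff.2 (hρk t₀ ht₀)
  have hev1 : ∀ᶠ y in 𝓝 z, ∀ t ∈ Metric.sphere (0 : ℂ) ρ, m / 2 < ‖P (y + t • v)‖ := by
    refine hsph.eventually_forall_of_forall_eventually fun t ht => ?_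
    have hc : Continuous fun p : E × ℂ => ‖P (p.1 + p.2 • v)‖ := by fun_prop
    have hlt : m / 2 < ‖P (z + t • v)‖ := (half_lt_self hmpos).trans_le (hmin ht)
    exact (hc.tendsto (z, t)).eventually_const_lt hlt
  have hev2 : ∀ᶠ y in 𝓝 z, ‖P y‖ < m / 2 := by
    have := (hPc.norm.tendsto z)
    rw [hz, norm_zero] at this
    exact this.eventually_lt_const (half_pos hmpos)
  have hev3 : ∀ᶠ y in 𝓝 z, dist z y < ε / 2 := by
    filter_upwards [Metric.ball_mem_nhds z (half_pos hε)] with y hy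
    rwa [dist_comm]
  -- the projections to the hyperplanes along `v`
  have hproj : ∀ᶠ y in 𝓝 z, ∃ i, P (y - (ℓ i y / ℓ i v) • v) = 0 := by
    filter_upwards [hev1, hev2, hev3] with y h1 h2 h3
    obtain ⟨t, ht, htz⟩ := exists_zero_of_norm_lt_on_sphere (φ := fun t => P (y + t • v)) hρ
      (by
        have : Differentiable ℂ (fun t : ℂ => P (y + t • v)) := fun t =>
          (hline y t (Set.mem_univ _)).differentiableAt
        exact this.diffContOnCl) (by simpa using h2) (fun t ht => (h1 t ht).le)
    have hd : dist z (y + t • v) < ε := by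
      have h4 : dist y (y + t • v) ≤ ρ * ‖v‖ := by
        rw [dist_self_add_right, norm_smul]
        exact mul_le_mul_of_nonneg_right (by simpa using (Metric.mem_ball.1 ht).le)
          (norm_nonneg _)
      linarith [dist_triangle z y (y + t • v)]
    have h5 : ¬ ∀ i, ℓ i (y + t • v) ≠ 0 := fun h => absurd hd (not_lt.2 (hcon _ ⟨htz, h⟩))
    push Not at h5
    obtain ⟨i, hi⟩ := h5
    refine ⟨i, ?_⟩
    have : t = - (ℓ i y / ℓ i v) := by
      rw [map_add, map_smul, smul_eq_mul] at hi
      have := hℓw i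
      field_simp
      linear_combination hi
    rw [this] at htz
    simpa [sub_eq_add_neg] using htz
  have hdense : Dense (⋂ i, {y | P (y - (ℓ i y / ℓ i v) • v) ≠ 0}) := by
    refine dense_iInter_of_isOpen (fun i => isOpen_ne_zero_of_continuous (by fun_prop))
      fun i => ?_
    obtain ⟨x, hx, hPx⟩ := hPℓ i
    refine dense_ne_zero_of_analyticOnNhd (x := x) (fun y _ => ?_) (by simpa [hx] using hPx)
    refine AnalyticAt.comp (hP _ (Set.mem_univ _)) (analyticAt_id.sub
      (AnalyticAt.smul ?_ analyticAt_const))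
    exact ((ℓ i).analyticAt _).div_const
  obtain ⟨y, hy⟩ := hdense.inter_nhds_nonempty hproj
  obtain ⟨i, hi⟩ := hy.2
  exact Set.mem_iInter.1 hy.1 i hi
end

/-- The order of `k` at `0` is read off from the growth of `k (c ^ d)`, where taking `t = c ^ d`
makes the `d`-th root of `t` available. -/
theorem le_analyticOrderAt_of_comp_pow {k u : ℂ → ℂ} {d m : ℕ} (hd : d ≠ 0) {L : ℂ}
    (hk : AnalyticAt ℂ k 0) (hku : ∀ᶠ c in 𝓝[≠] (0 : ℂ), k (c ^ d) = c ^ (d * m) * u c)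
    (hu : Tendsto u (𝓝[≠] 0) (𝓝 L)) :
    (m : ℕ∞) ≤ analyticOrderAt k 0 ∧ (L ≠ 0 → analyticOrderAt k 0 = m) := by
  have hpow : Tendsto (fun c : ℂ => c ^ d) (𝓝[≠] 0) (𝓝 0) := by
    have : Tendsto (fun c : ℂ => c ^ d) (𝓝[≠] 0) (𝓝 (0 ^ d)) :=
      ((continuous_pow d).tendsto _).mono_left nhdsWithin_le_nhds
    rwa [zero_pow hd] at this
  have hne : ∀ᶠ c in 𝓝[≠] (0 : ℂ), c ≠ 0 := self_mem_nhdsWithin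
  by_cases htop : analyticOrderAt k 0 = ⊤
  · rw [htop]
    refine ⟨le_top, fun hL => absurd ?_ hL⟩
    have h0 := hpow.eventually (analyticOrderAt_eq_top.1 htop)
    refine tendsto_nhds_unique hu (tendsto_const_nhds.congr' ?_)
    filter_upwards [h0, hku, hne] with c h1 h2 h3
    rw [h1] at h2
    exact (mul_eq_zero.1 h2.symm).resolve_left (pow_ne_zero _ h3) |>.symm
  · obtain ⟨n, hn⟩ := ENat.ne_top_iff_exists.1 htop
    rw [← hn]
    obtain ⟨g, hg, hg0, hkg⟩ := hk.analyticOrderAt_eq_natCast.1 hn.symm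
    have hgt : Tendsto (fun c : ℂ => g (c ^ d)) (𝓝[≠] 0) (𝓝 (g 0)) :=
      hg.continuousAt.tendsto.comp hpow
    have hkey : ∀ᶠ c in 𝓝[≠] (0 : ℂ), c ^ (d * n) * g (c ^ d) = c ^ (d * m) * u c := by
      filter_upwards [hpow.eventually hkg, hku] with c h1 h2
      rw [← h2, h1, sub_zero, smul_eq_mul, pow_mul]
    have haux : ∀ {a b : ℕ} {p q : ℂ → ℂ} {P Q : ℂ}, a < b →
        (∀ᶠ c in 𝓝[≠] (0 : ℂ), c ^ (d * a) * p c = c ^ (d * b) * q c) →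
        Tendsto p (𝓝[≠] 0) (𝓝 P) → Tendsto q (𝓝[≠] 0) (𝓝 Q) → P = 0 := by
      intro a b p q P Q hab h hp hq
      have h1 : Tendsto (fun c : ℂ => c ^ (d * (b - a)) * q c) (𝓝[≠] 0) (𝓝 (0 * Q)) := by
        refine Tendsto.mul ?_ hq
        have : Tendsto (fun c : ℂ => c ^ (d * (b - a))) (𝓝[≠] 0) (𝓝 (0 ^ (d * (b - a)))) :=
          ((continuous_pow _).tendsto _).mono_left nhdsWithin_le_nhds
        rwa [zero_pow (Nat.mul_ne_zero hd (by omega))] at this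
      rw [zero_mul] at h1
      refine tendsto_nhds_unique hp (h1.congr' ?_)
      filter_upwards [h, hne] with c h2 h3
      apply mul_left_cancel₀ (pow_ne_zero (d * a) h3)
      rw [h2, ← mul_assoc, ← pow_add, ← mul_add, Nat.add_sub_cancel' hab.le]
    constructor
    · by_contra hlt
      have hlt : n < m := by exact_mod_cast not_le.1 hlt
      exact hg0 (haux hlt hkey hgt hu)
    · intro hL
      by_contra hne'
      have hne' : n ≠ m := by exact_mod_cast hne'
      rcases lt_or_gt_of_ne hne' with hlt | hlt
      · exact hg0 (haux hlt hkey hgt hu)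
      · exact hL (haux hlt (hkey.mono fun c h => h.symm) hu hgt)

/-! ### The disc algebra and Weierstrass division -/

/-- The closed unit disc in `ℂ`. -/
abbrev closedUnitDisc : Set ℂ := Metric.closedBall 0 1

instance : CompactSpace closedUnitDisc := isCompact_iff_compactSpace.1 (isCompact_closedBall 0 1)

/-- The extension by zero to `ℂ` of a function on the closed unit disc. -/
noncomputable def discExtend (f : closedUnitDisc → ℂ) : ℂ → ℂ := Function.extend Subtype.val f 0

theorem discExtend_apply (f : closedUnitDisc → ℂ) {z : ℂ} (hz : z ∈ closedUnitDisc) :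
    discExtend f z = f ⟨z, hz⟩ :=
  Subtype.val_injective.extend_apply f 0 ⟨z, hz⟩

theorem discExtend_eqOn {f : closedUnitDisc → ℂ} {g : ℂ → ℂ} (h : ∀ z : closedUnitDisc, f z = g z) :
    Set.EqOn (discExtend f) g closedUnitDisc := fun z hz => by
  rw [discExtend_apply f hz, h]

theorem differentiableOn_discExtend_iff {f : closedUnitDisc → ℂ} {g : ℂ → ℂ}
    (h : ∀ z : closedUnitDisc, f z = g z) :
    DifferentiableOn ℂ (discExtend f) (Metric.ball 0 1) ↔
      DifferentiableOn ℂ g (Metric.ball 0 1) :=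
  differentiableOn_congr fun _ hz => discExtend_eqOn h (Metric.ball_subset_closedBall hz)

/-- The disc algebra: continuous functions on the closed unit disc that are holomorphic in its
interior, with the supremum norm. -/
noncomputable def discAlgebra : Subalgebra ℂ C(closedUnitDisc, ℂ) where
  carrier := {f | DifferentiableOn ℂ (discExtend f) (Metric.ball 0 1)}
  mul_mem' {f g} hf hg := by
    refine (differentiableOn_discExtend_iff (g := fun z => discExtend f z * discExtend g z)
      fun z => ?_).2 (DifferentiableOn.mul hf hg)
    simp [discExtend_apply _ z.2]
  add_mem' {f g} hf hg := by
    refine (differentiableOn_discExtend_iff (g := fun z => discExtend f z + discExtend g z)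
      fun z => ?_).2 (DifferentiableOn.add hf hg)
    simp [discExtend_apply _ z.2]
  algebraMap_mem' c := (differentiableOn_discExtend_iff (g := fun _ => c) fun z => rfl).2
    (differentiableOn_const c)

theorem mem_discAlgebra_iff {f : C(closedUnitDisc, ℂ)} :
    f ∈ discAlgebra ↔ DifferentiableOn ℂ (discExtend f) (Metric.ball 0 1) := Iff.rfl

theorem mem_discAlgebra {f : C(closedUnitDisc, ℂ)} {g : ℂ → ℂ}
    (h : ∀ z : closedUnitDisc, f z = g z) (hg : DifferentiableOn ℂ g (Metric.ball 0 1)) :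
    f ∈ discAlgebra :=
  (differentiableOn_discExtend_iff h).2 hg

theorem isClosed_discAlgebra : IsClosed (discAlgebra : Set C(closedUnitDisc, ℂ)) := by
  refine isClosed_of_closure_subset fun f hf => ?_
  rw [mem_closure_iff_nhdsWithin_neBot] at hf
  have h1 : Tendsto (fun g : C(closedUnitDisc, ℂ) => g) (𝓝[discAlgebra] f) (𝓝 f) :=
    tendsto_id.mono_left nhdsWithin_le_nhds
  rw [ContinuousMap.tendsto_iff_tendstoUniformly] at h1
  have h2 : TendstoUniformlyOn (fun (g : C(closedUnitDisc, ℂ)) z => discExtend g z)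
      (discExtend f) (𝓝[discAlgebra] f) (Metric.ball 0 1) := by
    intro u hu
    filter_upwards [h1 u hu] with g hg z hz
    have hz' := Metric.ball_subset_closedBall hz
    rw [discExtend_apply _ hz', discExtend_apply _ hz']
    exact hg ⟨z, hz'⟩
  exact h2.tendstoLocallyUniformlyOn.differentiableOn self_mem_nhdsWithin Metric.isOpen_ball

instance : CompleteSpace discAlgebra := isClosed_discAlgebra.completeSpace_coe

theorem discAlgebra_ext {f g : discAlgebra} (h : ∀ z, f.1 z = g.1 z) : f = g :=
  Subtype.ext (ContinuousMap.ext h)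

/-- The coordinate function of the disc algebra. -/
noncomputable def discCoord : discAlgebra :=
  ⟨⟨fun z => z, continuous_subtype_val⟩, mem_discAlgebra (g := id) (fun _ => rfl)
    differentiableOn_id⟩

@[simp] theorem discCoord_apply (z : closedUnitDisc) : discCoord.1 z = z := rfl

/-- Division by the coordinate; the quotient is the slope `dslope`, which is continuous up to the
boundary. -/
theorem exists_eq_algebraMap_add_coord_mul (f : discAlgebra) :
    ∃ h : discAlgebra, f = algebraMap ℂ _ (f.1 ⟨0, by simp⟩) + discCoord * h := by
  have hnhds : closedUnitDisc ∈ 𝓝 (0 : ℂ) := Metric.closedBall_mem_nhds _ one_pos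
  have hnhds' : Metric.ball (0 : ℂ) 1 ∈ 𝓝 (0 : ℂ) := Metric.ball_mem_nhds _ one_pos
  have hd : DifferentiableOn ℂ (discExtend f.1) (Metric.ball 0 1) := f.2
  have hc : ContinuousOn (discExtend f.1) closedUnitDisc := by
    rw [continuousOn_iff_continuous_domRestrict]
    exact f.1.continuous.congr fun z => (discExtend_apply _ z.2).symm
  have hc' : ContinuousOn (dslope (discExtend f.1) 0) closedUnitDisc :=
    (continuousOn_dslope hnhds).2 ⟨hc, hd.differentiableAt hnhds'⟩
  refine ⟨⟨⟨fun z => dslope (discExtend f.1) 0 z, hc'.domRestrict⟩,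
    mem_discAlgebra (fun _ => rfl) ((Complex.differentiableOn_dslope hnhds').2 hd)⟩,
    discAlgebra_ext fun z => ?_⟩
  have := sub_smul_dslope (discExtend f.1) 0 z
  rw [discExtend_apply _ z.2, discExtend_apply _ (by simp), sub_zero, smul_eq_mul] at this
  change f.1 z = f.1 ⟨0, _⟩ + z * dslope (discExtend f.1) 0 z
  rw [this]
  exact (add_sub_cancel _ _).symm

theorem eq_zero_of_coord_mul_eq_zero {f : discAlgebra} (h : discCoord * f = 0) : f = 0 := by
  have hne : ∀ z : closedUnitDisc, z.1 ≠ 0 → f.1 z = 0 := fun z hz => by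
    have : z.1 * f.1 z = 0 := congrArg (fun g : discAlgebra => g.1 z) h
    exact (mul_eq_zero.1 this).resolve_left hz
  refine discAlgebra_ext fun z => ?_
  by_cases hz : z.1 = 0
  · have hcl : IsClosed {w : closedUnitDisc | f.1 w = 0} :=
      isClosed_eq f.1.continuous continuous_const
    let a : ℕ → closedUnitDisc := fun n => ⟨((n + 1 : ℝ)⁻¹ : ℝ), by
      simp only [Metric.mem_closedBall, dist_zero_right, Complex.norm_real, norm_inv]
      rw [Real.norm_of_nonneg (by positivity)]
      exact inv_le_one_of_one_le₀ (by linarith [(Nat.cast_nonneg n : (0 : ℝ) ≤ n)])⟩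
    have ha : Tendsto a atTop (𝓝 z) := by
      rw [tendsto_subtype_rng, hz]
      have := tendsto_one_div_add_atTop_nhds_zero_nat (𝕜 := ℝ)
      simp only [one_div] at this
      exact (Complex.continuous_ofReal.tendsto' 0 0 rfl).comp this
    refine hcl.mem_of_tendsto ha (Eventually.of_forall fun n => hne _ ?_)
    simp only [a]
    exact_mod_cast (by positivity : ((n + 1 : ℝ)⁻¹) ≠ 0)
  · exact hne z hz

/-- Weierstrass division by the `n`-th power of the coordinate. -/
theorem exists_eq_coord_pow_mul_add (n : ℕ) (f : discAlgebra) :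
    ∃ (h : discAlgebra) (μ : Fin n → ℂ), f = discCoord ^ n * h + ∑ i, μ i • discCoord ^ (i : ℕ) := by
  induction n generalizing f with
  | zero => exact ⟨f, 0, by simp⟩
  | succ n ih =>
    obtain ⟨h, hh⟩ := exists_eq_algebraMap_add_coord_mul f
    obtain ⟨g, μ, hg⟩ := ih h
    refine ⟨g, Fin.cons (f.1 ⟨0, by simp⟩) μ, ?_⟩
    rw [Fin.sum_univ_succ]
    conv_lhs => rw [hh, hg]
    simp only [Fin.cons_zero, Fin.val_zero, pow_zero, Fin.cons_succ, Fin.val_succ, mul_add,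
      Finset.mul_sum, mul_smul_comm, pow_succ' discCoord, mul_assoc, Algebra.algebraMap_eq_smul_one]
    abel

theorem eq_zero_of_coord_pow_mul_add_eq_zero (n : ℕ) (h : discAlgebra) (μ : Fin n → ℂ)
    (h0 : discCoord ^ n * h + ∑ i, μ i • discCoord ^ (i : ℕ) = 0) : h = 0 ∧ μ = 0 := by
  induction n generalizing h with
  | zero => exact ⟨by simpa using h0, Subsingleton.elim _ _⟩
  | succ n ih =>
    rw [Fin.sum_univ_succ] at h0
    have h1 : μ 0 = 0 := by
      have := congrArg (fun g : discAlgebra => g.1 ⟨0, by simp⟩) h0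
      simpa [pow_succ] using this
    rw [h1, zero_smul, zero_add] at h0
    have h2 : discCoord * (discCoord ^ n * h +
        ∑ i : Fin n, μ i.succ • discCoord ^ (i : ℕ)) = 0 := by
      rw [← h0]
      simp only [Fin.val_succ, mul_add,
        Finset.mul_sum, mul_smul_comm, pow_succ' discCoord, mul_assoc]
    obtain ⟨h3, h4⟩ := ih h (fun i => μ i.succ) (eq_zero_of_coord_mul_eq_zero h2)
    refine ⟨h3, funext fun i => ?_⟩
    refine Fin.cases h1 (fun j => congrFun h4 j) i

/-- The monomial deformation as a polynomial map on the disc algebra: it sends `(g, lam)` to the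
function `z ↦ F (g z, lam)`, where `F` is the monomial deformation. -/
noncomputable def discUnfolding (d : ℕ) (p : discAlgebra × (Fin d → ℂ)) : discAlgebra :=
  p.1 ^ (d + 1) + ∑ i : Fin d, p.2 i • p.1 ^ (i : ℕ)

theorem discUnfolding_apply (d : ℕ) (p : discAlgebra × (Fin d → ℂ)) (z : closedUnitDisc) :
    (discUnfolding d p).1 z = monomialDeformation d (p.1.1 z, p.2) := by
  simp [discUnfolding, monomialDeformation]

theorem contDiff_discUnfolding (d : ℕ) (n : WithTop ℕ∞) : ContDiff ℂ n (discUnfolding d) := by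
  unfold discUnfolding
  fun_prop

/-- The derivative of `discUnfolding` at `(a, 0)`. -/
noncomputable def discUnfoldingDeriv (d : ℕ) (a : discAlgebra) :
    discAlgebra × (Fin d → ℂ) →L[ℂ] discAlgebra :=
  ((d + 1 : ℕ) • a ^ d) • ContinuousLinearMap.fst ℂ discAlgebra (Fin d → ℂ) +
    ∑ i : Fin d, ((ContinuousLinearMap.proj i).comp
      (ContinuousLinearMap.snd ℂ discAlgebra (Fin d → ℂ))).smulRight (a ^ (i : ℕ))

theorem hasFDerivAt_discUnfolding (d : ℕ) (a : discAlgebra) :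
    HasFDerivAt (discUnfolding d) (discUnfoldingDeriv d a) (a, 0) := by
  have h1 : HasFDerivAt (fun p : discAlgebra × (Fin d → ℂ) => p.1)
    (ContinuousLinearMap.fst ℂ discAlgebra (Fin d → ℂ)) (a, 0) := hasFDerivAt_fst
  have h2 : ∀ i : Fin d, HasFDerivAt (fun p : discAlgebra × (Fin d → ℂ) => p.2 i)
      ((ContinuousLinearMap.proj i).comp
      (ContinuousLinearMap.snd ℂ discAlgebra (Fin d → ℂ))) (a, 0) := fun i =>
    ((ContinuousLinearMap.proj (R := ℂ) (φ := fun _ : Fin d => ℂ) i).comp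
      (ContinuousLinearMap.snd ℂ discAlgebra (Fin d → ℂ))).hasFDerivAt
  refine HasFDerivAt.add ?_ (HasFDerivAt.fun_sum fun i _ => ?_)
  · exact h1.pow (d + 1)
  · convert (h2 i).smul (h1.pow (i : ℕ)) using 1
    · rfl
    · refine ContinuousLinearMap.ext fun p => ?_
      simp

theorem discUnfoldingDeriv_apply (d : ℕ) (R : ℂ) (h : discAlgebra) (μ : Fin d → ℂ) :
    discUnfoldingDeriv d (R • discCoord) (h, μ) =
      discCoord ^ d * (((d + 1 : ℂ) * R ^ d) • h) +
        ∑ i : Fin d, (μ i * R ^ (i : ℕ)) • discCoord ^ (i : ℕ) := by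
  simp only [discUnfoldingDeriv, smul_pow, add_apply,
    smul_apply, ContinuousLinearMap.coe_fst', smul_eq_mul,
    sum_apply, ContinuousLinearMap.smulRight_apply,
    ContinuousLinearMap.comp_apply, ContinuousLinearMap.coe_snd', ContinuousLinearMap.proj_apply,
    smul_smul]
  congr 1
  rw [← Nat.cast_smul_eq_nsmul ℂ, smul_smul, smul_mul_assoc, mul_smul_comm]
  push_cast
  rfl

/-- Infinitesimal versality of the monomial deformation, in the disc of radius `R`: modulo `z ^ d`, every
function is a unique linear combination of `1, z, …, z ^ (d - 1)`. -/
theorem bijective_discUnfoldingDeriv (d : ℕ) {R : ℂ} (hR : R ≠ 0) :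
    Function.Bijective (discUnfoldingDeriv d (R • discCoord)) := by
  have hd : (d + 1 : ℂ) * R ^ d ≠ 0 := mul_ne_zero (by exact_mod_cast d.succ_ne_zero)
    (pow_ne_zero _ hR)
  constructor
  · rw [injective_iff_map_eq_zero]
    rintro ⟨h, μ⟩ h0
    rw [discUnfoldingDeriv_apply] at h0
    obtain ⟨h1, h2⟩ := eq_zero_of_coord_pow_mul_add_eq_zero _ _ _ h0
    refine Prod.ext ((smul_eq_zero.1 h1).resolve_left hd) (funext fun i => ?_)
    exact (mul_eq_zero.1 (congrFun h2 i)).resolve_right (pow_ne_zero _ hR)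
  · intro f
    obtain ⟨h, μ, hf⟩ := exists_eq_coord_pow_mul_add d f
    refine ⟨(((d + 1 : ℂ) * R ^ d)⁻¹ • h, fun i => μ i / R ^ (i : ℕ)), ?_⟩
    rw [discUnfoldingDeriv_apply, smul_smul, mul_inv_cancel₀ hd, one_smul, hf]
    simp [div_mul_cancel₀ _ (pow_ne_zero _ hR)]

/-- `discUnfoldingDeriv` at the function `z ↦ R z`, as an isomorphism. -/
noncomputable def discUnfoldingEquiv (d : ℕ) {R : ℂ} (hR : R ≠ 0) :
    (discAlgebra × (Fin d → ℂ)) ≃L[ℂ] discAlgebra :=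
  ContinuousLinearEquiv.ofBijective (discUnfoldingDeriv d (R • discCoord))
    (LinearMap.ker_eq_bot.2 (bijective_discUnfoldingDeriv d hR).1)
    (LinearMap.range_eq_top.2 (bijective_discUnfoldingDeriv d hR).2)

theorem hasStrictFDerivAt_discUnfolding (d : ℕ) {R : ℂ} (hR : R ≠ 0) :
    HasStrictFDerivAt (discUnfolding d) (discUnfoldingEquiv d hR :
      (discAlgebra × (Fin d → ℂ)) →L[ℂ] discAlgebra) (R • discCoord, 0) :=
  ((contDiff_discUnfolding d 1).contDiffAt).hasStrictFDerivAt'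
    (hasFDerivAt_discUnfolding d _) one_ne_zero

/-! ### Holomorphic families as analytic maps to the disc algebra -/

section
variable {k : ℕ}

/-- The linear map `(t, s) ↦ (t z, s)`. -/
noncomputable def discScale (k : ℕ) (z : ℂ) :
    ℂ × (Fin k → ℂ) →L[ℂ] ℂ × (Fin k → ℂ) :=
  ((ContinuousLinearMap.mul ℂ ℂ).flip z).prodMap (ContinuousLinearMap.id ℂ (Fin k → ℂ))

/-- The multilinear map that sends `(t_i, s_i)` to the function `z ↦ p ((t_i z, s_i))_i` of the disc
algebra. -/
noncomputable def discMultilinear {n : ℕ}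
    (p : (ℂ × (Fin k → ℂ)) [×n]→L[ℂ] ℂ) : (ℂ × (Fin k → ℂ)) [×n]→L[ℂ] discAlgebra :=
  MultilinearMap.mkContinuous
    { toFun := fun v => ⟨⟨fun z => p fun i => ((v i).1 * z, (v i).2), by fun_prop⟩,
        mem_discAlgebra (g := fun z => p fun i => ((v i).1 * z, (v i).2)) (fun _ => rfl) (by
          refine Differentiable.differentiableOn
            (((p.contDiff (n := 1)).differentiable one_ne_zero).comp ?_)
          fun_prop)⟩
      map_update_add' := by
        intro _ v i x y
        exact discAlgebra_ext fun z =>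
          (p.compContinuousLinearMap fun _ => discScale k z).map_update_add v i x y
      map_update_smul' := by
        intro _ v i c x
        exact discAlgebra_ext fun z =>
          (p.compContinuousLinearMap fun _ => discScale k z).map_update_smul v i c x }
    ‖p‖ (by
      intro v
      have hB : 0 ≤ ‖p‖ * ∏ i, ‖v i‖ := by positivity
      change ‖(_ : C(closedUnitDisc, ℂ))‖ ≤ _
      refine (ContinuousMap.norm_le _ hB).2 fun z => ?_
      refine (p.le_opNorm _).trans ?_
      gcongr with i
      rw [Prod.norm_def, Prod.norm_def]
      refine max_le_max ?_ le_rfl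
      rw [norm_mul]
      exact mul_le_of_le_one_right (norm_nonneg _) (mem_closedBall_zero_iff.1 z.2))

theorem norm_discMultilinear_le {n : ℕ} (p : (ℂ × (Fin k → ℂ)) [×n]→L[ℂ] ℂ) :
    ‖discMultilinear p‖ ≤ ‖p‖ :=
  MultilinearMap.mkContinuous_norm_le _ (norm_nonneg _) _

/-- A holomorphic germ `G (z, s)` induces an analytic map `(t, s) ↦ (z ↦ G (t z, s))` to the disc
algebra: substitute `(t z, s)` into the power series of `G`. -/
theorem exists_analyticOnNhd_discAlgebra {G : ℂ × (Fin k → ℂ) → ℂ} (hG : AnalyticAt ℂ G (0, 0)) :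
    ∃ (ρ : ℝ) (Ψ : ℂ × (Fin k → ℂ) → discAlgebra), 0 < ρ ∧
      AnalyticOnNhd ℂ Ψ (Metric.ball 0 ρ) ∧
      ∀ v ∈ Metric.ball 0 ρ, ∀ z : closedUnitDisc, (Ψ v).1 z = G (v.1 * z, v.2) := by
  obtain ⟨p, r, hp⟩ := hG
  let P : FormalMultilinearSeries ℂ (ℂ × (Fin k → ℂ)) discAlgebra := fun n => discMultilinear (p n)
  have hPr : p.radius ≤ P.radius := by
    refine ENNReal.le_of_forall_nnreal_lt fun a ha => ?_
    obtain ⟨C, -, hC⟩ := p.norm_mul_pow_le_of_lt_radius ha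
    refine P.le_radius_of_bound C fun n => (?_ : _ ≤ _).trans (hC n)
    gcongr
    exact norm_discMultilinear_le _
  have hrP : r ≤ P.radius := hp.r_le.trans hPr
  have hP := P.hasFPowerSeriesOnBall (hp.r_pos.trans_le hrP)
  obtain ⟨ρ, hρ, hρr⟩ := ENNReal.lt_iff_exists_nnreal_btwn.1 hp.r_pos
  have hsub : Metric.ball (0 : ℂ × (Fin k → ℂ)) ρ ⊆ Metric.eball 0 r := by
    rw [← Metric.eball_coe]
    exact Metric.eball_subset_eball hρr.le
  refine ⟨ρ, P.sum, by exact_mod_cast hρ, ?_, ?_⟩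
  · exact hP.analyticOnNhd.mono (hsub.trans (Metric.eball_subset_eball hrP))
  · intro v hv z
    have h1 := hP.hasSum (Metric.eball_subset_eball hrP (hsub hv))
    rw [zero_add] at h1
    let ev : discAlgebra →ₗ[ℂ] ℂ :=
      { toFun := fun f => f.1 z, map_add' := fun _ _ => rfl, map_smul' := fun _ _ => rfl }
    have hev : Continuous ev := (continuous_eval_const z).comp continuous_subtype_val
    have h2 := h1.map ev hev
    have hv' : (v.1 * z, v.2) ∈ Metric.ball (0 : ℂ × (Fin k → ℂ)) ρ := by
      rw [mem_ball_zero_iff] at hv ⊢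
      refine lt_of_le_of_lt ?_ hv
      rw [Prod.norm_def, Prod.norm_def]
      refine max_le_max ?_ le_rfl
      rw [norm_mul]
      exact mul_le_of_le_one_right (norm_nonneg _) (mem_closedBall_zero_iff.1 z.2)
    have h3 := hp.hasSum (hsub hv')
    have h4 : ((0, 0) : ℂ × (Fin k → ℂ)) + (v.1 * z, v.2) = (v.1 * z, v.2) := by simp
    rw [h4] at h3
    exact h2.unique h3

end

/-! ### Versality of the monomial deformation -/

theorem analyticAt_monomialDeformation (d : ℕ) (p : ℂ × (Fin d → ℂ)) :
    AnalyticAt ℂ (monomialDeformation d) p := by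
  have h : ContDiff ℂ ⊤ (monomialDeformation d) := by
    unfold monomialDeformation
    fun_prop
  exact h.contDiffAt.analyticAt

/-- Versality of the monomial deformation: every deformation of `z ^ (d + 1)` is induced from it. This
is the inverse function theorem for `discUnfolding` at `(R z, 0)`. -/
theorem IsDeformation.exists_eq_monomialDeformation {d k : ℕ} {F : ℂ × (Fin k → ℂ) → ℂ}
    (hF : IsDeformation (fun z : ℂ => z ^ (d + 1)) F) :
    ∀ᶠ R : ℝ in 𝓝[>] 0, ∃ (g : (Fin k → ℂ) → discAlgebra) (θ : (Fin k → ℂ) → (Fin d → ℂ)),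
      ContinuousAt g 0 ∧ g 0 = (R : ℂ) • discCoord ∧ AnalyticAt ℂ θ 0 ∧ θ 0 = 0 ∧
      ∀ᶠ s in 𝓝 0, ∀ z : closedUnitDisc,
        F ((R : ℂ) * z, s) = monomialDeformation d ((g s).1 z, θ s) := by
  obtain ⟨ρ, Ψ, hρ, hΨ, hΨF⟩ := exists_analyticOnNhd_discAlgebra hF.analyticAt
  obtain ⟨δ, hδ, hbase⟩ := Metric.eventually_nhds_iff.1 hF.base_eq
  filter_upwards [self_mem_nhdsWithin, nhdsWithin_le_nhds (eventually_lt_nhds hρ),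
    nhdsWithin_le_nhds (eventually_lt_nhds hδ)] with R hR hRρ hRδ
  have hR : 0 < R := hR
  have hRC : (R : ℂ) ≠ 0 := by exact_mod_cast hR.ne'
  have hnR : ‖(R : ℂ)‖ = R := by simp [abs_of_pos hR]
  have hmem : ((R : ℂ), (0 : Fin k → ℂ)) ∈ Metric.ball (0 : ℂ × (Fin k → ℂ)) ρ := by
    rw [mem_ball_zero_iff, Prod.norm_def]
    simpa [hnR, abs_of_pos hR] using ⟨hRρ, hρ⟩
  set a : discAlgebra × (Fin d → ℂ) := ((R : ℂ) • discCoord, 0) with ha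
  have hC : ContDiffAt ℂ ⊤ (discUnfolding d) a := (contDiff_discUnfolding d ⊤).contDiffAt
  have hD : HasFDerivAt (discUnfolding d) (discUnfoldingEquiv d hRC :
      (discAlgebra × (Fin d → ℂ)) →L[ℂ] discAlgebra) a :=
    (hasStrictFDerivAt_discUnfolding d hRC).hasFDerivAt
  let I := hC.localInverse hD (by simp)
  have hIa : I (discUnfolding d a) = a := hC.localInverse_apply_image hD (by simp)
  have hIC : AnalyticAt ℂ I (discUnfolding d a) := (hC.to_localInverse hD (by simp)).analyticAt
  have hIr : ∀ᶠ y in 𝓝 (discUnfolding d a), discUnfolding d (I y) = y :=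
    (hC.hasStrictFDerivAt' hD (by simp)).eventually_right_inverse
  have hΨa : Ψ ((R : ℂ), 0) = discUnfolding d a := by
    refine discAlgebra_ext fun z => ?_
    rw [hΨF _ hmem, discUnfolding_apply]
    have hz : ‖(z : ℂ)‖ ≤ 1 := mem_closedBall_zero_iff.1 z.2
    have : F ((R : ℂ) * z, 0) = ((R : ℂ) * z) ^ (d + 1) := by
      refine hbase ?_
      rw [dist_zero_right, norm_mul, hnR]
      exact (mul_le_of_le_one_right hR.le hz).trans_lt hRδ
    simp only [this]
    simp [a, monomialDeformation]
  have hcurve : AnalyticAt ℂ (fun s : Fin k → ℂ => Ψ ((R : ℂ), s)) 0 :=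
    (hΨ _ hmem).comp (f := fun s : Fin k → ℂ => ((R : ℂ), s))
      (analyticAt_const.prod analyticAt_id)
  have hJ : AnalyticAt ℂ (fun s : Fin k → ℂ => I (Ψ ((R : ℂ), s))) 0 := by
    refine AnalyticAt.comp (g := I) ?_ hcurve
    rw [hΨa]; exact hIC
  have hJ0 : I (Ψ ((R : ℂ), 0)) = a := by rw [hΨa, hIa]
  refine ⟨fun s => (I (Ψ ((R : ℂ), s))).1, fun s => (I (Ψ ((R : ℂ), s))).2,
    hJ.continuousAt.fst, ?_, analyticAt_snd.comp hJ, ?_, ?_⟩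
  · simp only [hJ0, a]
  · simp only [hJ0, a]
  · have h1 : ∀ᶠ s in 𝓝 (0 : Fin k → ℂ), discUnfolding d (I (Ψ ((R : ℂ), s))) = Ψ ((R : ℂ), s) := by
      have := hcurve.continuousAt.tendsto
      simp only [hΨa] at this
      exact this.eventually hIr
    have h2 : ∀ᶠ s in 𝓝 (0 : Fin k → ℂ), ((R : ℂ), s) ∈ Metric.ball (0 : ℂ × (Fin k → ℂ)) ρ :=
      (Continuous.continuousAt (by fun_prop : Continuous fun s : Fin k → ℂ => ((R : ℂ), s))).tendsto
        |>.eventually (Metric.isOpen_ball.mem_nhds hmem)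
    filter_upwards [h1, h2] with s h1 h2 z
    rw [← hΨF _ h2, ← discUnfolding_apply, h1]

/-- Rigidity of the monomial deformation: coordinate changes close to the identity cannot identify two
different members of the family with small parameters, because `discUnfolding` is locally injective. -/
theorem eventually_eq_of_monomialDeformation_eq {d : ℕ} {R : ℂ} (hR : R ≠ 0)
    {X : Type*} {l : Filter X} {G : X → discAlgebra} {Θ Λ : X → (Fin d → ℂ)}
    (hG : Tendsto G l (𝓝 (R • discCoord))) (hΘ : Tendsto Θ l (𝓝 0)) (hΛ : Tendsto Λ l (𝓝 0))
    (h : ∀ᶠ x in l, ∀ z : closedUnitDisc,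
      monomialDeformation d ((G x).1 z, Θ x) = monomialDeformation d (R * z, Λ x)) :
    ∀ᶠ x in l, Θ x = Λ x := by
  have hinv := (hasStrictFDerivAt_discUnfolding d hR).eventually_left_inverse
  have h1 := (hG.prodMk_nhds hΘ).eventually hinv
  have h2 := ((tendsto_const_nhds (x := R • discCoord)).prodMk_nhds hΛ).eventually hinv
  filter_upwards [h, h1, h2] with x hx h1 h2
  have : discUnfolding d (G x, Θ x) = discUnfolding d (R • discCoord, Λ x) := by
    refine discAlgebra_ext fun z => ?_
    rw [discUnfolding_apply, discUnfolding_apply]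
    exact hx z
  rw [this, h2] at h1
  exact (congrArg Prod.snd h1).symm

/-- If `F` is induced from the monomial deformation by `θ`, and the monomial deformation is induced
from `F` by `θ'`, then `θ ∘ θ'` is the identity germ. -/
theorem eventually_comp_eq_id {d k : ℕ} {F : ℂ × (Fin k → ℂ) → ℂ} {R : ℝ} (hR : 0 < R)
    {g : (Fin k → ℂ) → discAlgebra} {θ : (Fin k → ℂ) → (Fin d → ℂ)}
    (hg : ContinuousAt g 0) (hg0 : g 0 = (R : ℂ) • discCoord)
    (hθ : ContinuousAt θ 0) (hθ0 : θ 0 = 0)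
    (hF : ∀ᶠ s in 𝓝 0, ∀ z : closedUnitDisc,
      F ((R : ℂ) * z, s) = monomialDeformation d ((g s).1 z, θ s))
    {g' : ℂ × (Fin d → ℂ) → ℂ} {θ' : (Fin d → ℂ) → (Fin k → ℂ)}
    (hg' : AnalyticAt ℂ g' (0, 0)) (hθ' : ContinuousAt θ' 0) (hθ'0 : θ' 0 = 0)
    (hg'0 : ∀ᶠ z in 𝓝 (0 : ℂ), g' (z, 0) = z)
    (hM : ∀ᶠ p in 𝓝 ((0, 0) : ℂ × (Fin d → ℂ)), monomialDeformation d p = F (g' p, θ' p.2)) :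
    ∀ᶠ x in 𝓝 (0 : Fin d → ℂ), θ (θ' x) = x := by
  have hRC : (R : ℂ) ≠ 0 := by exact_mod_cast hR.ne'
  have hθ't : Tendsto θ' (𝓝 0) (𝓝 0) := by simpa only [hθ'0] using hθ'.tendsto
  have hθt : Tendsto θ (𝓝 0) (𝓝 0) := by simpa only [hθ0] using hθ.tendsto
  -- a polydisc on which all the germs are represented
  obtain ⟨δ, hδ, hball⟩ : ∃ δ > 0, ∀ p ∈ Metric.ball ((0, 0) : ℂ × (Fin d → ℂ)) δ,
      AnalyticAt ℂ g' p ∧ monomialDeformation d p = F (g' p, θ' p.2) :=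
    Metric.eventually_nhds_iff_ball.1 (hg'.eventually_analyticAt.and hM)
  obtain ⟨δ', hδ', hball'⟩ := Metric.eventually_nhds_iff_ball.1 hg'0
  obtain ⟨r, hr, hrδ, hrδ', hrR⟩ : ∃ r : ℝ, 0 < r ∧ r < δ ∧ r < δ' ∧ r < R := by
    refine ⟨min δ (min δ' R) / 2, by positivity, ?_, ?_, ?_⟩
    · exact (half_lt_self (by positivity)).trans_le (min_le_left _ _)
    · exact (half_lt_self (by positivity)).trans_le ((min_le_right _ _).trans (min_le_left _ _))
    · exact (half_lt_self (by positivity)).trans_le ((min_le_right _ _).trans (min_le_right _ _))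
  have hrC : (r : ℂ) ≠ 0 := by exact_mod_cast hr.ne'
  have hK : IsCompact (Metric.closedBall (0 : ℂ) r) := isCompact_closedBall _ _
  -- uniform closeness of `g' (·, x)` to the identity
  have hunif : ∀ ε > 0, ∀ᶠ x in 𝓝 (0 : Fin d → ℂ), ∀ z ∈ Metric.closedBall (0 : ℂ) r,
      ‖g' (z, x) - z‖ < ε := by
    intro ε hε
    refine hK.eventually_forall_of_forall_eventually fun z hz => ?_
    have hz' : ‖z‖ ≤ r := mem_closedBall_zero_iff.1 hz
    have hzb : (z, (0 : Fin d → ℂ)) ∈ Metric.ball ((0, 0) : ℂ × (Fin d → ℂ)) δ := by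
      rw [Metric.mem_ball, Prod.dist_eq]
      simpa using hz'.trans_lt hrδ
    have hc : ContinuousAt (fun p : (Fin d → ℂ) × ℂ => ‖g' (p.2, p.1) - p.2‖) (0, z) := by
      have := (hball _ hzb).1.continuousAt
      have h2 : ContinuousAt (fun p : (Fin d → ℂ) × ℂ => g' (p.2, p.1)) (0, z) :=
        ContinuousAt.comp (f := fun p : (Fin d → ℂ) × ℂ => (p.2, p.1)) (g := g') this
          (by fun_prop)
      exact (h2.sub continuousAt_snd).norm
    refine hc.tendsto.eventually_lt_const ?_
    rw [hball' z (mem_ball_zero_iff.2 (hz'.trans_lt hrδ'))]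
    simpa using hε
  have hmem : ∀ᶠ x in 𝓝 (0 : Fin d → ℂ), ∀ z ∈ Metric.closedBall (0 : ℂ) r,
      (z, x) ∈ Metric.ball ((0, 0) : ℂ × (Fin d → ℂ)) δ := by
    filter_upwards [Metric.ball_mem_nhds (0 : Fin d → ℂ) hδ] with x hx z hz
    rw [Metric.mem_ball, Prod.dist_eq]
    exact max_lt ((Metric.mem_closedBall.1 hz).trans_lt hrδ) hx
  have hscale : ∀ z : closedUnitDisc, (r : ℂ) * z ∈ Metric.closedBall (0 : ℂ) r := by
    intro z
    rw [mem_closedBall_zero_iff, norm_mul, Complex.norm_real, Real.norm_of_nonneg hr.le]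
    exact mul_le_of_le_one_right hr.le (mem_closedBall_zero_iff.1 z.2)
  have hin : ∀ᶠ x in 𝓝 (0 : Fin d → ℂ), ∀ z ∈ Metric.closedBall (0 : ℂ) r,
      g' (z, x) / R ∈ Metric.ball (0 : ℂ) 1 := by
    filter_upwards [hunif (R - r) (sub_pos.2 hrR)] with x hx z hz
    have h1 := hx z hz
    have h2 : ‖z‖ ≤ r := mem_closedBall_zero_iff.1 hz
    rw [mem_ball_zero_iff, norm_div, Complex.norm_real, Real.norm_of_nonneg hR.le, div_lt_one hR]
    calc ‖g' (z, x)‖ = ‖(g' (z, x) - z) + z‖ := by rw [sub_add_cancel]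
      _ ≤ ‖g' (z, x) - z‖ + ‖z‖ := norm_add_le _ _
      _ < R := by linarith
  have hgood : ∀ᶠ x in 𝓝 (0 : Fin d → ℂ), ∃ G : discAlgebra,
      ∀ z : closedUnitDisc, G.1 z = discExtend (g (θ' x)).1 (g' ((r : ℂ) * z, x) / R) := by
    filter_upwards [hmem, hin] with x hx hx'
    have hdiff : ∀ z ∈ closedUnitDisc, DifferentiableAt ℂ
        (fun z => discExtend (g (θ' x)).1 (g' ((r : ℂ) * z, x) / R)) z := by
      intro z hz
      have h1 : DifferentiableAt ℂ g' ((r : ℂ) * z, x) :=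
        (hball _ (hx _ (hscale ⟨z, hz⟩))).1.differentiableAt
      have h2 : DifferentiableAt ℂ (fun z : ℂ => g' ((r : ℂ) * z, x) / R) z :=
        (DifferentiableAt.comp z h1 (by fun_prop)).div_const _
      have h3 : DifferentiableAt ℂ (discExtend (g (θ' x)).1) (g' ((r : ℂ) * z, x) / R) :=
        (mem_discAlgebra_iff.1 (g (θ' x)).2).differentiableAt
          (Metric.isOpen_ball.mem_nhds (hx' _ (hscale ⟨z, hz⟩)))
      exact DifferentiableAt.comp (g := discExtend (g (θ' x)).1)
        (f := fun z : ℂ => g' ((r : ℂ) * z, x) / R) z h3 h2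
    have hcont : ContinuousOn (fun z => discExtend (g (θ' x)).1 (g' ((r : ℂ) * z, x) / R))
        closedUnitDisc := fun z hz => (hdiff z hz).continuousAt.continuousWithinAt
    exact ⟨⟨⟨_, hcont.domRestrict⟩, mem_discAlgebra (fun _ => rfl) fun z hz =>
      (hdiff z (Metric.ball_subset_closedBall hz)).differentiableWithinAt⟩, fun _ => rfl⟩
  obtain ⟨G, hG⟩ := hgood.choice
  have hgt : Tendsto (fun x => ‖g (θ' x) - (R : ℂ) • discCoord‖) (𝓝 0) (𝓝 0) := by
    have := (hg.tendsto.comp hθ't)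
    rw [hg0, tendsto_iff_norm_sub_tendsto_zero] at this
    exact this
  have hGt : Tendsto G (𝓝 0) (𝓝 ((r : ℂ) • discCoord)) := by
    rw [tendsto_iff_norm_sub_tendsto_zero, Metric.tendsto_nhds]
    intro ε hε
    filter_upwards [hG, hin, hunif (ε / 4) (by positivity),
      hgt.eventually_lt_const (by positivity : 0 < ε / 4)] with x h1 h2 h3 h4
    rw [dist_zero_right, norm_norm]
    have hle : ‖G x - (r : ℂ) • discCoord‖ ≤ ε / 2 := by
      change ‖(G x).1 - ((r : ℂ) • discCoord).1‖ ≤ _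
      refine (ContinuousMap.norm_le _ (by positivity)).2 fun z => ?_
      change ‖(G x).1 z - (r : ℂ) * z‖ ≤ _
      have hw := Metric.ball_subset_closedBall (h2 _ (hscale z))
      rw [h1, discExtend_apply _ hw]
      set w := g' ((r : ℂ) * z, x)
      have h5 : ‖(g (θ' x)).1 ⟨w / R, hw⟩ - w‖ ≤ ε / 4 := by
        have := ContinuousMap.norm_coe_le_norm (g (θ' x) - (R : ℂ) • discCoord).1 ⟨w / R, hw⟩
        have h6 : (g (θ' x) - (R : ℂ) • discCoord).1 ⟨w / R, hw⟩ =
            (g (θ' x)).1 ⟨w / R, hw⟩ - w := by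
          change _ - (R : ℂ) * (w / R) = _
          rw [mul_div_cancel₀ _ hRC]
        rw [h6] at this
        exact this.trans h4.le
      calc _ = ‖((g (θ' x)).1 ⟨w / R, hw⟩ - w) + (w - (r : ℂ) * z)‖ := by
            rw [sub_add_sub_cancel]
        _ ≤ ε / 4 + ε / 4 := (norm_add_le _ _).trans (add_le_add h5 (h3 _ (hscale z)).le)
        _ = ε / 2 := by ring
    linarith
  refine eventually_eq_of_monomialDeformation_eq hrC hGt (hθt.comp hθ't) tendsto_id ?_
  filter_upwards [hG, hin, hmem, hθ't.eventually hF] with x h1 h2 h3 h4 z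
  have hw := Metric.ball_subset_closedBall (h2 _ (hscale z))
  rw [h1, discExtend_apply _ hw]
  have := h4 ⟨_, hw⟩
  simp only [mul_div_cancel₀ _ hRC] at this
  exact this.symm.trans (hball _ (h3 _ (hscale z))).2.symm

/-! ### Linear relations between four numbers -/

section
variable {d : ℕ}

/-- The `i`-th coordinate of `ℂ^d`. -/
noncomputable abbrev coordForm (i : Fin d) : (Fin d → ℂ) →L[ℂ] ℂ :=
  ContinuousLinearMap.proj (R := ℂ) (φ := fun _ : Fin d => ℂ) i

/-- The linear form `α_a + α_b - α_c - α_f` on `ℂ^d`, where `(a, b, c, f)` are the values of `e`. -/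
noncomputable def stokesForm (e : Fin 4 ↪ Fin d) : (Fin d → ℂ) →L[ℂ] ℂ :=
  coordForm (e 0) + coordForm (e 1) - coordForm (e 2) - coordForm (e 3)

theorem stokesForm_apply (e : Fin 4 ↪ Fin d) (α : Fin d → ℂ) :
    stokesForm e α = α (e 0) + α (e 1) - α (e 2) - α (e 3) := rfl

/-- For a set `S` of four indices, three times the product of the three forms
`α_a + α_b - α_c - α_f` attached to the splittings of `S` into pairs (see `stokesCubic_map`). It is
written in terms of power sums, so that the symmetry is evident. -/
def stokesCubic {A : Type*} [CommRing A] (S : Finset (Fin d)) (α : Fin d → A) : A :=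
  (∑ i ∈ S, α i) ^ 3 - 6 * (∑ i ∈ S, α i) * (∑ i ∈ S, α i ^ 2) + 8 * ∑ i ∈ S, α i ^ 3

/-- The product of all the forms `α_a + α_b - α_c - α_f`, one for every pair of disjoint pairs of
indices, up to a constant factor. It is a symmetric polynomial. -/
def stokesProduct {A : Type*} [CommRing A] (α : Fin d → A) : A :=
  ∏ S ∈ Finset.powersetCard 4 Finset.univ, stokesCubic S α

/-- The cubic splits into the forms of the three splittings of a set of four indices into pairs. -/
theorem stokesCubic_map (e : Fin 4 ↪ Fin d) (α : Fin d → ℂ) :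
    stokesCubic (Finset.univ.map e) α = stokesForm e α *
      (3 * stokesForm ((Equiv.swap 1 2).toEmbedding.trans e) α *
        stokesForm ((Equiv.swap 1 3).toEmbedding.trans e) α) := by
  have h1 : Equiv.swap (1 : Fin 4) 2 0 = 0 := by decide
  have h2 : Equiv.swap (1 : Fin 4) 2 3 = 3 := by decide
  have h3 : Equiv.swap (1 : Fin 4) 3 0 = 0 := by decide
  have h4 : Equiv.swap (1 : Fin 4) 3 2 = 2 := by decide
  simp only [stokesCubic, Finset.sum_map, Fin.sum_univ_four, stokesForm_apply,
    Function.Embedding.trans_apply, Equiv.coe_toEmbedding, Equiv.swap_apply_left,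
    Equiv.swap_apply_right, h1, h2, h3, h4]
  ring

theorem exists_map_univ_eq {S : Finset (Fin d)} (hS : S ∈ Finset.powersetCard 4 Finset.univ) :
    ∃ e : Fin 4 ↪ Fin d, Finset.univ.map e = S :=
  ⟨_, Finset.map_orderEmbOfFin_univ S (Finset.mem_powersetCard.1 hS).2⟩

theorem map_univ_mem_powersetCard (e : Fin 4 ↪ Fin d) :
    Finset.univ.map e ∈ Finset.powersetCard 4 (Finset.univ : Finset (Fin d)) :=
  Finset.mem_powersetCard.2 ⟨Finset.subset_univ _, by simp⟩

theorem stokesCubic_eq_zero_iff {S : Finset (Fin d)}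
    (hS : S ∈ Finset.powersetCard 4 Finset.univ) (α : Fin d → ℂ) :
    stokesCubic S α = 0 ↔ ∃ e : Fin 4 ↪ Fin d, Finset.univ.map e = S ∧ stokesForm e α = 0 := by
  constructor
  · intro h
    obtain ⟨e, he⟩ := exists_map_univ_eq hS
    rw [← he, stokesCubic_map] at h
    have hmap : ∀ σ : Equiv.Perm (Fin 4), Finset.univ.map (σ.toEmbedding.trans e) = S := by
      intro σ
      rw [← Finset.map_map, Finset.map_univ_equiv, he]
    rcases mul_eq_zero.1 h with h | h
    · exact ⟨e, he, h⟩
    · rcases mul_eq_zero.1 h with h | h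
      · exact ⟨_, hmap _, (mul_eq_zero.1 h).resolve_left (by norm_num)⟩
      · exact ⟨_, hmap _, h⟩
  · rintro ⟨e, rfl, h⟩
    rw [stokesCubic_map, h, zero_mul]

theorem stokesProduct_eq_zero_iff (α : Fin d → ℂ) :
    stokesProduct α = 0 ↔ ∃ e : Fin 4 ↪ Fin d, stokesForm e α = 0 := by
  rw [stokesProduct, Finset.prod_eq_zero_iff]
  constructor
  · rintro ⟨S, hS, h⟩
    obtain ⟨e, -, he⟩ := (stokesCubic_eq_zero_iff hS α).1 h
    exact ⟨e, he⟩
  · rintro ⟨e, he⟩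
    exact ⟨_, map_univ_mem_powersetCard e, (stokesCubic_eq_zero_iff
      (map_univ_mem_powersetCard e) α).2 ⟨e, rfl, he⟩⟩

theorem stokesCubic_smul (c : ℂ) (S : Finset (Fin d)) (α : Fin d → ℂ) :
    stokesCubic S (c • α) = c ^ 3 * stokesCubic S α := by
  simp only [stokesCubic, Pi.smul_apply, smul_eq_mul, mul_pow, ← Finset.mul_sum]
  ring

theorem stokesProduct_smul (c : ℂ) (α : Fin d → ℂ) :
    stokesProduct (c • α) = c ^ (3 * d.choose 4) * stokesProduct α := by
  simp only [stokesProduct, stokesCubic_smul, Finset.prod_mul_distrib, Finset.prod_const,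
    Finset.card_powersetCard, Finset.card_univ, Fintype.card_fin, pow_mul]

theorem stokesProduct_add_const (c : ℂ) (α : Fin d → ℂ) :
    stokesProduct (fun i => α i + c) = stokesProduct α := by
  refine Finset.prod_congr rfl fun S hS => ?_
  obtain ⟨e, rfl⟩ := exists_map_univ_eq hS
  simp only [stokesCubic_map, stokesForm_apply]
  ring

theorem map_stokesProduct {A B : Type*} [CommRing A] [CommRing B] (f : A →+* B)
    (α : Fin d → A) : f (stokesProduct α) = stokesProduct (fun i => f (α i)) := by
  simp [stokesProduct, stokesCubic, map_prod, map_sum, map_ofNat f]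

theorem stokesProduct_comp_perm {A : Type*} [CommRing A] (σ : Equiv.Perm (Fin d))
    (α : Fin d → A) :
    stokesProduct (α ∘ σ) = stokesProduct α := by
  refine Finset.prod_equiv σ.finsetCongr (fun S => ?_) fun S _ => ?_
  · simp [Finset.mem_powersetCard]
  · simp [stokesCubic, Equiv.finsetCongr_apply]

theorem stokesForm_single_of_notMem {e : Fin 4 ↪ Fin d} {k : Fin d} (hk : ∀ j, e j ≠ k) :
    stokesForm e (Pi.single k 1) = 0 := by
  simp [stokesForm_apply, hk]

theorem stokesForm_single_apply_ne_zero (e : Fin 4 ↪ Fin d) (j : Fin 4) :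
    stokesForm e (Pi.single (e j) 1) ≠ 0 := by
  fin_cases j <;> simp [stokesForm_apply]

/-- `stokesProduct` divided by its factor `stokesForm e`. -/
noncomputable def stokesCofactor (e : Fin 4 ↪ Fin d) (α : Fin d → ℂ) : ℂ :=
  (3 * stokesForm ((Equiv.swap 1 2).toEmbedding.trans e) α *
    stokesForm ((Equiv.swap 1 3).toEmbedding.trans e) α) *
  ∏ T ∈ (Finset.powersetCard 4 Finset.univ).erase (Finset.univ.map e), stokesCubic T α

theorem stokesProduct_eq_mul_stokesCofactor (e : Fin 4 ↪ Fin d) (α : Fin d → ℂ) :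
    stokesProduct α = stokesForm e α * stokesCofactor e α := by
  rw [stokesProduct, ← Finset.mul_prod_erase _ _ (map_univ_mem_powersetCard e),
    stokesCubic_map, stokesCofactor]
  simp only [mul_assoc]

theorem differentiable_stokesCofactor (e : Fin 4 ↪ Fin d) :
    Differentiable ℂ (stokesCofactor e) := by
  have : Differentiable ℂ fun α : Fin d → ℂ =>
      ∏ T ∈ (Finset.powersetCard 4 Finset.univ).erase (Finset.univ.map e), stokesCubic T α :=
    (contDiff_prod (n := 1) fun T _ => by unfold stokesCubic; fun_prop).differentiable one_ne_zero
  unfold stokesCofactor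
  fun_prop

theorem hasFDerivAt_stokesProduct {e : Fin 4 ↪ Fin d} {β : Fin d → ℂ}
    (h0 : stokesForm e β = 0) :
    HasFDerivAt stokesProduct (stokesCofactor e β • stokesForm e) β := by
  have hH : stokesProduct = fun α : Fin d → ℂ => stokesForm e α * stokesCofactor e α :=
    funext (stokesProduct_eq_mul_stokesCofactor e)
  have h := (stokesForm e).hasFDerivAt (x := β) |>.mul
    (differentiable_stokesCofactor e β).hasFDerivAt
  rw [hH]
  refine h.congr_fderiv (ContinuousLinearMap.ext fun x => ?_)
  simp [h0]

/-- The cofactor is nonzero outside the zeros of the forms which do not vanish on the hyperplane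
`stokesForm e = 0`: no other factor of `stokesProduct` is proportional to `stokesForm e`. -/
theorem stokesCofactor_ne_zero {e : Fin 4 ↪ Fin d} {β : Fin d → ℂ}
    (hβ1 : ∀ e' : Fin 4 ↪ Fin d, (∃ x, stokesForm e' x = 0 ∧ stokesForm e x ≠ 0) →
      stokesForm e' β ≠ 0) : stokesCofactor e β ≠ 0 := by
  set S := Finset.univ.map e with hS
  have hx : stokesForm e (Pi.single (e 0) 1 + Pi.single (e 1) 1) ≠ 0 := by
    simp [stokesForm_apply]
  have hswap : ∀ σ : Equiv.Perm (Fin 4),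
      stokesForm (σ.toEmbedding.trans e) (Pi.single (e 0) 1 + Pi.single (e 1) 1) = 0 →
      stokesForm (σ.toEmbedding.trans e) β ≠ 0 := fun σ h => hβ1 _ ⟨_, h, hx⟩
  refine mul_ne_zero (mul_ne_zero (mul_ne_zero (by norm_num) (hswap _ ?_)) (hswap _ ?_))
    (Finset.prod_ne_zero_iff.2 fun T hT h => ?_)
  · have h1 : Equiv.swap (1 : Fin 4) 2 0 = 0 := by decide
    have h2 : Equiv.swap (1 : Fin 4) 2 3 = 3 := by decide
    simp [stokesForm_apply, h1, h2]
  · have h3 : Equiv.swap (1 : Fin 4) 3 0 = 0 := by decide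
    have h4 : Equiv.swap (1 : Fin 4) 3 2 = 2 := by decide
    simp [stokesForm_apply, h3, h4]
  · obtain ⟨hTS, hT⟩ := Finset.mem_erase.1 hT
    obtain ⟨e', he', h0'⟩ := (stokesCubic_eq_zero_iff hT β).1 h
    have hcard : T.card = S.card := by
      rw [(Finset.mem_powersetCard.1 hT).2, hS]; simp
    obtain ⟨k, hkS, hkT⟩ : ∃ k ∈ S, k ∉ T := by
      by_contra! hcon
      exact hTS (Finset.eq_of_subset_of_card_le hcon hcard.le).symm
    obtain ⟨j, -, rfl⟩ := Finset.mem_map.1 hkS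
    refine hβ1 e' ⟨Pi.single (e j) 1, stokesForm_single_of_notMem fun i hi => hkT ?_,
      stokesForm_single_apply_ne_zero e j⟩ h0'
    rw [← he', ← hi]
    exact Finset.mem_map_of_mem _ (Finset.mem_univ i)

/-- A generic point of the hyperplane `stokesForm e = 0` has distinct coordinates, and is a simple zero
of `stokesProduct`. -/
theorem mem_closure_generic_of_stokesForm_eq_zero {e : Fin 4 ↪ Fin d} {α : Fin d → ℂ}
    (hα : stokesForm e α = 0) :
    α ∈ closure {β | stokesForm e β = 0 ∧ Function.Injective β ∧
      DifferentiableAt ℂ stokesProduct β ∧ fderiv ℂ stokesProduct β ≠ 0} := by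
  let ℓ : {p : Fin d × Fin d // p.1 ≠ p.2} ⊕
      {e' : Fin 4 ↪ Fin d // ∃ x, stokesForm e' x = 0 ∧ stokesForm e x ≠ 0} →
      (Fin d → ℂ) →L[ℂ] ℂ := Sum.elim
    (fun p => coordForm p.1.1 - coordForm p.1.2) (fun e' => stokesForm e'.1)
  have hℓ : ∀ i, ℓ i ≠ 0 := by
    rintro (⟨p, hp⟩ | ⟨e', _⟩) h
    · have := DFunLike.congr_fun h (Pi.single p.1 1)
      change Pi.single (M := fun _ => ℂ) p.1 1 p.1 - Pi.single (M := fun _ => ℂ) p.1 1 p.2 = 0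
        at this
      simp [hp.symm] at this
    · exact stokesForm_single_apply_ne_zero e' 0 (DFunLike.congr_fun h _)
  have hker : ∀ i, ∃ x, ℓ i x = 0 ∧ stokesForm e x ≠ 0 := by
    rintro (⟨p, hp⟩ | ⟨e', he'⟩)
    · obtain ⟨j, hj1, hj2⟩ : ∃ j, e j ≠ p.1 ∧ e j ≠ p.2 := by
        by_contra! hcon
        have hsub : Finset.univ.map e ⊆ {p.1, p.2} := fun k hk => by
          obtain ⟨j, -, rfl⟩ := Finset.mem_map.1 hk
          by_cases h : e j = p.1
          · simp [h]
          · simp [hcon j h]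
        have := (Finset.card_le_card hsub).trans Finset.card_le_two
        simp at this
      refine ⟨Pi.single (e j) 1, ?_, stokesForm_single_apply_ne_zero e j⟩
      change Pi.single (M := fun _ => ℂ) (e j) 1 p.1 - Pi.single (M := fun _ => ℂ) (e j) 1 p.2 = 0
      simp [hj1.symm, hj2.symm]
    · exact he'
  refine closure_mono ?_ (zeros_subset_closure_diff_hyperplanes (P := stokesForm e)
    (fun x _ => (stokesForm e).analyticAt x) (stokesForm_single_apply_ne_zero e 0) ℓ hℓ hker hα)
  rintro β ⟨h0, hβ⟩
  have hd := hasFDerivAt_stokesProduct h0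
  refine ⟨h0, fun i j hij => ?_, hd.differentiableAt, ?_⟩
  · by_contra hne
    exact hβ (Sum.inl ⟨(i, j), hne⟩) (sub_eq_zero.2 hij)
  · rw [hd.fderiv]
    intro h
    have h1 := DFunLike.congr_fun h (Pi.single (e 0) 1)
    rcases mul_eq_zero.1 h1 with h2 | h2
    · exact stokesCofactor_ne_zero (fun e' he' => hβ (Sum.inr ⟨e', he'⟩)) h2
    · exact stokesForm_single_apply_ne_zero e 0 h2
end

/-! ### Critical points as functions of the parameters -/

section
variable {d : ℕ}

/-- The polynomial `z^{d+1} + λ_{d-1} z^{d-1} + ⋯ + λ_0`. -/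
noncomputable def monomialPoly (lam : Fin d → ℂ) : Polynomial ℂ :=
  Polynomial.X ^ (d + 1) + ∑ i : Fin d, Polynomial.C (lam i) * Polynomial.X ^ (i : ℕ)

theorem eval_monomialPoly (lam : Fin d → ℂ) (x : ℂ) :
    (monomialPoly lam).eval x = monomialDeformation d (x, lam) := by
  simp [monomialPoly, monomialDeformation, Polynomial.eval_finsetSum]

theorem deriv_monomialDeformation (lam : Fin d → ℂ) (x : ℂ) :
    deriv (fun w => monomialDeformation d (w, lam)) x = (monomialPoly lam).derivative.eval x := by
  simp only [← eval_monomialPoly]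
  exact Polynomial.deriv _

theorem coeff_monomialPoly (lam : Fin d → ℂ) (n : ℕ) :
    (monomialPoly lam).coeff n =
      (if n = d + 1 then 1 else 0) + if h : n < d then lam ⟨n, h⟩ else 0 := by
  simp only [monomialPoly, Polynomial.coeff_add, Polynomial.coeff_X_pow,
    Polynomial.finsetSum_coeff, Polynomial.coeff_C_mul]
  congr 1
  split_ifs with h
  · rw [Finset.sum_eq_single ⟨n, h⟩]
    · simp
    · intro b _ hb
      rw [if_neg, mul_zero]
      rintro rfl
      exact hb rfl
    · simp
  · refine Finset.sum_eq_zero fun i _ => ?_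
    rw [if_neg, mul_zero]
    rintro rfl
    exact h i.2

theorem coeff_derivative_monomialPoly (lam : Fin d → ℂ) (n : ℕ) :
    (monomialPoly lam).derivative.coeff n =
      (if n = d then (d + 1 : ℂ) else 0) +
        if h : n + 1 < d then (n + 1 : ℂ) * lam ⟨n + 1, h⟩ else 0 := by
  rw [Polynomial.coeff_derivative, coeff_monomialPoly]
  by_cases h1 : n = d
  · subst h1; simp
  · rw [if_neg h1, if_neg (by omega), zero_add, zero_add]
    split_ifs
    · ring
    · ring

/-- `z` lists the critical points, with multiplicities, of the function with the parameter `lam`. -/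
def IsCriticalConfig (z : Fin d → ℂ) (lam : Fin d → ℂ) : Prop :=
  (monomialPoly lam).derivative =
    Polynomial.C (d + 1 : ℂ) * ∏ j, (Polynomial.X - Polynomial.C (z j))

theorem IsCriticalConfig.eval_derivative {z lam : Fin d → ℂ} (h : IsCriticalConfig z lam) (x : ℂ) :
    (monomialPoly lam).derivative.eval x = (d + 1) * ∏ j, (x - z j) := by
  rw [h]
  simp [Polynomial.eval_prod]

theorem exists_map_univ_val_eq {α : Type*} {n : ℕ} (s : Multiset α) (hs : s.card = n) :
    ∃ z : Fin n → α, Finset.univ.val.map z = s := by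
  obtain ⟨l, rfl⟩ : ∃ l : List α, s = l := ⟨s.toList, s.coe_toList.symm⟩
  obtain rfl : l.length = n := hs
  exact ⟨l.get, by rw [Fin.univ_val_map, List.ofFn_get]⟩

theorem natDegree_derivative_monomialPoly (lam : Fin d → ℂ) :
    (monomialPoly lam).derivative.natDegree = d := by
  refine Polynomial.natDegree_eq_of_le_of_coeff_ne_zero ?_ ?_
  · rw [Polynomial.natDegree_le_iff_coeff_eq_zero]
    intro n hn
    rw [coeff_derivative_monomialPoly, if_neg (by omega), dif_neg (by omega), add_zero]
  · rw [coeff_derivative_monomialPoly, if_pos rfl, dif_neg (by omega), add_zero]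
    exact_mod_cast d.succ_ne_zero

theorem leadingCoeff_derivative_monomialPoly (lam : Fin d → ℂ) :
    (monomialPoly lam).derivative.leadingCoeff = d + 1 := by
  rw [Polynomial.leadingCoeff, natDegree_derivative_monomialPoly, coeff_derivative_monomialPoly,
    if_pos rfl, dif_neg (by omega), add_zero]

theorem exists_isCriticalConfig (lam : Fin d → ℂ) : ∃ z, IsCriticalConfig z lam := by
  have hs := IsAlgClosed.splits (monomialPoly lam).derivative
  obtain ⟨z, hz⟩ := exists_map_univ_val_eq (monomialPoly lam).derivative.roots
    (hs.natDegree_eq_card_roots.symm.trans (natDegree_derivative_monomialPoly lam))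
  refine ⟨z, ?_⟩
  have := hs.eq_prod_roots
  rw [leadingCoeff_derivative_monomialPoly, ← hz, Multiset.map_map] at this
  exact this

theorem isCriticalConfig_of_injective {z lam : Fin d → ℂ} (hz : Function.Injective z)
    (h : ∀ j, (monomialPoly lam).derivative.eval (z j) = 0) : IsCriticalConfig z lam := by
  obtain ⟨w, hw⟩ := exists_isCriticalConfig lam
  have hzw : ∀ j, ∃ i, w i = z j := fun j => by
    have := h j
    rw [hw.eval_derivative, mul_eq_zero, Finset.prod_eq_zero_iff] at this
    rcases this with h1 | ⟨i, -, hi⟩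
    · exact absurd h1 (by exact_mod_cast d.succ_ne_zero)
    · exact ⟨i, (sub_eq_zero.1 hi).symm⟩
  choose σ hσ using hzw
  have hinj : Function.Injective σ := fun i j hij => hz (by rw [← hσ, ← hσ, hij])
  have hbij : Function.Bijective σ := Finite.injective_iff_bijective.1 hinj
  rw [IsCriticalConfig, hw]
  congr 1
  rw [← hbij.prod_comp]
  simp only [hσ]

theorem IsCriticalConfig.exists_eq {z lam : Fin d → ℂ} (h : IsCriticalConfig z lam) {x : ℂ}
    (hx : (monomialPoly lam).derivative.eval x = 0) : ∃ j, z j = x := by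
  rw [h.eval_derivative, mul_eq_zero, Finset.prod_eq_zero_iff] at hx
  rcases hx with h1 | ⟨i, -, hi⟩
  · exact absurd h1 (by exact_mod_cast d.succ_ne_zero)
  · exact ⟨i, (sub_eq_zero.1 hi).symm⟩

theorem IsCriticalConfig.eval_eq_zero {z lam : Fin d → ℂ} (h : IsCriticalConfig z lam)
    (j : Fin d) : (monomialPoly lam).derivative.eval (z j) = 0 := by
  rw [h.eval_derivative, Finset.prod_eq_zero (Finset.mem_univ j) (sub_self _), mul_zero]

/-- The `k`-th elementary symmetric function of the numbers `z j`. -/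
noncomputable def esymmEval (k : ℕ) (z : Fin d → ℂ) : ℂ :=
  MvPolynomial.aeval z (MvPolynomial.esymm (Fin d) ℂ k)

theorem esymmEval_one (z : Fin d → ℂ) : esymmEval 1 z = ∑ j, z j := by
  simp [esymmEval, MvPolynomial.esymm_one]

theorem esymmEval_smul (k : ℕ) (c : ℂ) (z : Fin d → ℂ) :
    esymmEval k (c • z) = c ^ k * esymmEval k z := by
  simp only [esymmEval, MvPolynomial.esymm, map_sum, map_prod, MvPolynomial.aeval_X,
    Finset.mul_sum, Pi.smul_apply, smul_eq_mul, Finset.prod_mul_distrib, Finset.prod_const]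
  refine Finset.sum_congr rfl fun t ht => ?_
  rw [(Finset.mem_powersetCard.1 ht).2]

theorem coeff_prod_X_sub_C (z : Fin d → ℂ) {n : ℕ} (hn : n ≤ d) :
    (∏ j, (Polynomial.X - Polynomial.C (z j))).coeff n = (-1) ^ (d - n) * esymmEval (d - n) z := by
  have h := Multiset.prod_X_sub_C_coeff (Finset.univ.val.map z) (k := n) (by simpa using hn)
  rw [Multiset.map_map] at h
  simp only [Multiset.card_map, Finset.card_val, Finset.card_univ, Fintype.card_fin] at h
  rw [esymmEval, MvPolynomial.aeval_esymm_eq_multiset_esymm, ← h]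
  rfl

/-- The coefficients `λ_i`, `i ≠ 0`, of the polynomial with derivative `(d + 1) ∏ (X - z j)`, expressed
by the Vieta formulas. The value at `i = 0` is irrelevant: it is `0`, by division by zero. -/
noncomputable def vietaParam (z : Fin d → ℂ) (i : Fin d) : ℂ :=
  ((-1) ^ (d + 1 - i : ℕ) * (d + 1) / (i : ℕ)) * esymmEval (d + 1 - i) z

/-- Vieta's formulas. -/
theorem isCriticalConfig_iff (hd : d ≠ 0) {z lam : Fin d → ℂ} :
    IsCriticalConfig z lam ↔
      ∑ j, z j = 0 ∧ ∀ i : Fin d, (i : ℕ) ≠ 0 → lam i = vietaParam z i := by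
  have hd1 : (d + 1 : ℂ) ≠ 0 := by exact_mod_cast d.succ_ne_zero
  have hlow : ∀ n, n ≤ d → (Polynomial.C (d + 1 : ℂ) *
      ∏ j, (Polynomial.X - Polynomial.C (z j))).coeff n =
        (d + 1) * ((-1) ^ (d - n) * esymmEval (d - n) z) := fun n hn => by
    rw [Polynomial.coeff_C_mul, coeff_prod_X_sub_C z hn]
  have hstep : ∀ (n : ℕ) (h : n + 1 < d),
      (n + 1 : ℂ) * lam ⟨n + 1, h⟩ = (d + 1) * ((-1) ^ (d - n) * esymmEval (d - n) z) ↔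
        lam ⟨n + 1, h⟩ = vietaParam z ⟨n + 1, h⟩ := fun n h => by
    have hn : (n + 1 : ℂ) ≠ 0 := by exact_mod_cast n.succ_ne_zero
    simp only [vietaParam, Nat.add_sub_add_right, Nat.cast_add, Nat.cast_one]
    rw [div_mul_eq_mul_div, eq_div_iff hn]
    constructor <;> intro h' <;> linear_combination h'
  rw [IsCriticalConfig, Polynomial.ext_iff]
  constructor
  · intro h
    constructor
    · have h1 := h (d - 1)
      rw [hlow _ (by omega), coeff_derivative_monomialPoly, if_neg (by omega), dif_neg (by omega),
        show d - (d - 1) = 1 by omega, esymmEval_one] at h1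
      simpa [hd1] using h1
    · rintro ⟨i, hi⟩ hi0
      obtain ⟨n, rfl⟩ := Nat.exists_eq_succ_of_ne_zero hi0
      have h1 := h n
      rw [hlow _ (by omega), coeff_derivative_monomialPoly, if_neg (by omega), dif_pos hi,
        zero_add] at h1
      exact (hstep n hi).1 h1
  · rintro ⟨h1, h2⟩ n
    rcases lt_trichotomy n d with hn | rfl | hn
    · rw [hlow _ hn.le, coeff_derivative_monomialPoly, if_neg hn.ne, zero_add]
      split_ifs with h
      · exact (hstep n h).2 (h2 _ (by simp))
      · rw [show d - n = 1 by omega, esymmEval_one, h1]; simp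
    · rw [hlow _ le_rfl, coeff_derivative_monomialPoly, if_pos rfl, dif_neg (by omega)]
      simp [esymmEval]
    · rw [coeff_derivative_monomialPoly, if_neg (by omega), dif_neg (by omega), add_zero]
      refine (Polynomial.coeff_eq_zero_of_natDegree_lt (lt_of_le_of_lt ?_ hn)).symm
      refine (Polynomial.natDegree_C_mul_le _ _).trans ?_
      rw [Polynomial.natDegree_finsetProd_X_sub_C_eq_card]
      simp

end

/-! ### The equation of the pure Stokes' set -/

section
variable {d : ℕ}

/-- The critical values at the points `z j`. -/
def criticalValues (z lam : Fin d → ℂ) (j : Fin d) : ℂ := monomialDeformation d (z j, lam)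

/-- The `j`-th critical value, for the free term zero, as a polynomial in the critical points. -/
noncomputable def valuePoly (d : ℕ) (j : Fin d) : MvPolynomial (Fin d) ℂ :=
  MvPolynomial.X j ^ (d + 1) + ∑ i : Fin d,
    MvPolynomial.C ((-1) ^ (d + 1 - i : ℕ) * (d + 1) / (i : ℕ) : ℂ) *
      MvPolynomial.esymm (Fin d) ℂ (d + 1 - i) * MvPolynomial.X j ^ (i : ℕ)

theorem aeval_valuePoly (z : Fin d → ℂ) (j : Fin d) :
    MvPolynomial.aeval z (valuePoly d j) = criticalValues z (vietaParam z) j := by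
  simp [valuePoly, criticalValues, monomialDeformation, vietaParam, esymmEval]

theorem monomialDeformation_eq_add_const {lam mu : Fin d → ℂ} (h : ∀ i : Fin d, (i : ℕ) ≠ 0 →
    lam i = mu i) : ∃ c, ∀ x, monomialDeformation d (x, lam) = monomialDeformation d (x, mu) + c := by
  refine ⟨∑ i : Fin d, if (i : ℕ) = 0 then lam i - mu i else 0, fun x => ?_⟩
  simp only [monomialDeformation, add_assoc, ← Finset.sum_add_distrib]
  congr 1
  refine Finset.sum_congr rfl fun i _ => ?_
  split_ifs with hi
  · rw [hi]; ring
  · rw [h i hi, add_zero]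

theorem isSymmetric_stokesProduct_valuePoly :
    MvPolynomial.IsSymmetric (stokesProduct (valuePoly d)) := by
  intro σ
  have h : ∀ j, MvPolynomial.rename σ (valuePoly d j) = valuePoly d (σ j) := by
    intro j
    simp only [valuePoly, map_add, map_sum, map_mul, map_pow, MvPolynomial.rename_X,
      MvPolynomial.rename_C, MvPolynomial.rename_esymm]
  have := map_stokesProduct (MvPolynomial.rename (R := ℂ) σ).toRingHom (valuePoly d)
  refine this.trans ?_
  rw [← stokesProduct_comp_perm σ (valuePoly d)]
  exact congrArg _ (funext h)

/-- By the fundamental theorem on symmetric polynomials, `stokesProduct` of the critical values is a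
polynomial in the coefficients of the derivative, hence in the parameters. -/
theorem exists_stokesEquation (hd : d ≠ 0) : ∃ h : (Fin d → ℂ) → ℂ,
    AnalyticOnNhd ℂ h Set.univ ∧
    ∀ z lam, IsCriticalConfig z lam → h lam = stokesProduct (criticalValues z lam) := by
  obtain ⟨q, hq⟩ := MvPolynomial.esymmAlgHom_surjective (σ := Fin d) (n := d) ℂ (by simp)
    ⟨_, isSymmetric_stokesProduct_valuePoly (d := d)⟩
  have hq : MvPolynomial.aeval (fun i : Fin d => MvPolynomial.esymm (Fin d) ℂ (i + 1)) q =
      stokesProduct (valuePoly d) := by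
    rw [← MvPolynomial.esymmAlgHom_apply, hq]
  let E : (Fin d → ℂ) → Fin d → ℂ := fun lam j =>
    (-1) ^ (j + 1 : ℕ) / (d + 1) * (if h : d - j < d then ((d - j : ℕ) : ℂ) * lam ⟨d - j, h⟩ else 0)
  refine ⟨fun lam => MvPolynomial.aeval (E lam) q, ?_, fun z lam hz => ?_⟩
  · refine AnalyticOnNhd.aeval_mvPolynomial (fun j lam _ => ?_) q
    simp only [E]
    split_ifs
    · exact analyticAt_const.mul (analyticAt_const.mul ((coordForm _).analyticAt _))
    · exact analyticAt_const
  · obtain ⟨h1, h2⟩ := (isCriticalConfig_iff hd).1 hz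
    have hE : E lam = fun j : Fin d => esymmEval (j + 1) z := by
      funext j
      simp only [E]
      have hd1 : (d + 1 : ℂ) ≠ 0 := by exact_mod_cast d.succ_ne_zero
      split_ifs with h
      · have hj : ((d - j : ℕ) : ℂ) ≠ 0 := by
          exact_mod_cast (by have := j.2; omega : d - (j : ℕ) ≠ 0)
        rw [h2 _ (by have := j.2; simp; omega), vietaParam]
        have hj' : d + 1 - (d - (j : ℕ)) = j + 1 := by have := j.2; omega
        simp only [hj']
        have hs : ((-1 : ℂ) ^ (j + 1 : ℕ)) * (-1) ^ (j + 1 : ℕ) = 1 := by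
          rw [← mul_pow]; simp
        field_simp
        linear_combination (esymmEval (↑j + 1) z) * hs
      · have hj : (j : ℕ) = 0 := by omega
        rw [mul_zero, hj, zero_add, esymmEval_one, h1]
    obtain ⟨c, hc⟩ := monomialDeformation_eq_add_const h2
    have hval : criticalValues z lam = fun j => criticalValues z (vietaParam z) j + c :=
      funext fun j => hc _
    rw [hval, stokesProduct_add_const]
    have h3 := congrArg (MvPolynomial.aeval z) hq
    have h4 : MvPolynomial.aeval z (stokesProduct (valuePoly d)) =
        stokesProduct (criticalValues z (vietaParam z)) := by
      refine (map_stokesProduct (MvPolynomial.aeval (R := ℂ) z).toRingHom (valuePoly d)).trans ?_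
      exact congrArg _ (funext fun j => aeval_valuePoly z j)
    rw [← h4, ← h3]
    change MvPolynomial.aeval (E lam) q = _
    rw [hE, ← AlgHom.comp_apply, MvPolynomial.comp_aeval]
    rfl

/-- The equation of the pure Stokes' set of the monomial deformation: the polynomial in the
parameters equal to `stokesProduct` of the critical values. -/
noncomputable def stokesEquation (hd : d ≠ 0) : (Fin d → ℂ) → ℂ := (exists_stokesEquation hd).choose

theorem analyticOnNhd_stokesEquation (hd : d ≠ 0) :
    AnalyticOnNhd ℂ (stokesEquation hd) Set.univ := (exists_stokesEquation hd).choose_spec.1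

theorem IsCriticalConfig.stokesEquation_eq (hd : d ≠ 0) {z lam : Fin d → ℂ}
    (hz : IsCriticalConfig z lam) :
    stokesEquation hd lam = stokesProduct (criticalValues z lam) :=
  (exists_stokesEquation hd).choose_spec.2 z lam hz

/-- Quasihomogeneity: `λ_i` has weight `d + 1 - i`. The equation does not depend on the free
term, so nothing is required of `lam 0`. -/
theorem stokesEquation_scale (hd : d ≠ 0) {lam mu : Fin d → ℂ} {c : ℂ}
    (h : ∀ i : Fin d, (i : ℕ) ≠ 0 → lam i = c ^ (d + 1 - i : ℕ) * mu i) :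
    stokesEquation hd lam = c ^ ((d + 1) * (3 * d.choose 4)) * stokesEquation hd mu := by
  obtain ⟨z, hz⟩ := exists_isCriticalConfig mu
  have hz' : IsCriticalConfig (c • z) lam := by
    obtain ⟨h1, h2⟩ := (isCriticalConfig_iff hd).1 hz
    refine (isCriticalConfig_iff hd).2 ⟨?_, fun i hi => ?_⟩
    · simp [← Finset.mul_sum, h1]
    · rw [h i hi, h2 i hi, vietaParam, vietaParam, esymmEval_smul]
      ring
  rw [hz.stokesEquation_eq, hz'.stokesEquation_eq]
  obtain ⟨b, hb⟩ := monomialDeformation_eq_add_const (mu := fun i => c ^ (d + 1 - i : ℕ) * mu i) h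
  have hval : criticalValues (c • z) lam = fun j => (c ^ (d + 1) • criticalValues z mu) j + b := by
    funext j
    simp only [criticalValues, hb, Pi.smul_apply, smul_eq_mul]
    congr 1
    simp only [monomialDeformation, mul_add, mul_pow, Finset.mul_sum]
    congr 1
    refine Finset.sum_congr rfl fun i _ => ?_
    have : c ^ (d + 1) = c ^ (d + 1 - i : ℕ) * c ^ (i : ℕ) := by
      rw [← pow_add, Nat.sub_add_cancel (by have := i.2; omega)]
    rw [this]; ring
  rw [hval, stokesProduct_add_const, stokesProduct_smul, ← pow_mul]

/-- For odd `d`, two different pairs of `d`-th roots of the same nonzero number have different sums: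
the numbers lie on a circle, where a nonzero sum determines the pair, and no two of them are
opposite. -/
theorem add_ne_add_of_pow_eq {a b c e w : ℂ} (hd : Odd d) (hw : w ≠ 0) (ha : a ^ d = w)
    (hb : b ^ d = w) (hc : c ^ d = w) (he : e ^ d = w) (hac : a ≠ c) (hae : a ≠ e) :
    a + b ≠ c + e := by
  intro h
  have hd0 : d ≠ 0 := by rintro rfl; simp at hd
  have hne : ∀ {x : ℂ}, x ^ d = w → x ≠ 0 := by
    rintro x hx rfl
    rw [zero_pow hd0] at hx
    exact hw hx.symm
  have hnorm : ∀ {x : ℂ}, x ^ d = w → (starRingEnd ℂ) x = (‖a‖ : ℂ) ^ 2 / x := by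
    intro x hx
    have hxa : ‖x‖ = ‖a‖ := by
      have : ‖x‖ ^ d = ‖a‖ ^ d := by rw [← norm_pow, ← norm_pow, hx, ha]
      exact (pow_left_inj₀ (norm_nonneg _) (norm_nonneg _) hd0).1 this
    rw [eq_div_iff (hne hx), ← hxa, mul_comm, Complex.mul_conj, Complex.normSq_eq_norm_sq]
    push_cast; rfl
  by_cases hab : a + b = 0
  · have h1 : a = -b := by linear_combination hab
    have h2 : a ^ d = - b ^ d := by rw [h1, hd.neg_pow]
    rw [ha, hb] at h2
    exact hw (by linear_combination h2 / 2)
  · have h1 := congrArg (starRingEnd ℂ) h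
    rw [map_add, map_add, hnorm ha, hnorm hb, hnorm hc, hnorm he] at h1
    have ha0 := hne ha
    have hb0 := hne hb
    have hc0 := hne hc
    have he0 := hne he
    have hN : (‖a‖ : ℂ) ≠ 0 := by exact_mod_cast (norm_ne_zero_iff.2 ha0)
    field_simp at h1
    have h2 : (a + b) * (c * e - a * b) = 0 := by
      linear_combination h1 - (a * b) * h
    have h3 : c * e = a * b := by
      have := (mul_eq_zero.1 h2).resolve_left hab
      linear_combination this
    have h4 : (a - c) * (a - e) = 0 := by
      have hbb : b = c + e - a := by linear_combination h
      rw [hbb] at h3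
      linear_combination h3
    rcases mul_eq_zero.1 h4 with h5 | h5
    · exact hac (sub_eq_zero.1 h5)
    · exact hae (sub_eq_zero.1 h5)

/-- For the function `z^{d+1} + z`, the critical values are proportional to the `d`-th roots of `-1`. -/
theorem stokesEquation_ne_zero (hd : d ≠ 0) (hodd : Odd d) :
    stokesEquation hd (fun i => if (i : ℕ) = 1 then 1 else 0) ≠ 0 := by
  set lam : Fin d → ℂ := fun i => if (i : ℕ) = 1 then 1 else 0 with hlam
  obtain ⟨z, hz⟩ := exists_isCriticalConfig lam
  rw [hz.stokesEquation_eq]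
  intro h0
  obtain ⟨e, he⟩ := (stokesProduct_eq_zero_iff _).1 h0
  have hd4 : 4 ≤ d := by simpa using Fintype.card_le_of_embedding e
  have hM : ∀ x, monomialDeformation d (x, lam) = x ^ (d + 1) + x := by
    intro x
    rw [monomialDeformation, Finset.sum_eq_single ⟨1, by omega⟩]
    · simp [hlam]
    · intro i _ hi
      have : (i : ℕ) ≠ 1 := fun h => hi (Fin.ext h)
      simp [hlam, this]
    · simp
  have hd1 : (d + 1 : ℂ) ≠ 0 := by exact_mod_cast d.succ_ne_zero
  have hder : ∀ x, (monomialPoly lam).derivative.eval x = (d + 1) * x ^ d + 1 := by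
    intro x
    rw [← deriv_monomialDeformation]
    simp only [hM]
    simp
  have hroot : ∀ j, z j ^ d = -1 / (d + 1) := fun j => by
    have := hz.eval_eq_zero j
    rw [hder] at this
    field_simp
    linear_combination this
  have hw : (-1 / (d + 1) : ℂ) ≠ 0 := div_ne_zero (by norm_num) hd1
  have hinj : Function.Injective z := by
    intro i j hij
    by_contra hne
    have hp : (monomialPoly lam).derivative =
        Polynomial.C (d + 1 : ℂ) * Polynomial.X ^ d + 1 :=
      Polynomial.funext fun x => by rw [hder]; simp
    rw [IsCriticalConfig, hp, ← Finset.mul_prod_erase _ _ (Finset.mem_univ i),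
      ← Finset.mul_prod_erase _ _ (Finset.mem_erase.2 ⟨Ne.symm hne, Finset.mem_univ j⟩),
      ← hij] at hz
    have h1 := congrArg (fun p => p.derivative.eval (z i)) hz
    simp only [Polynomial.derivative_add, Polynomial.derivative_mul, Polynomial.derivative_C,
      Polynomial.derivative_X_pow, Polynomial.derivative_one, Polynomial.derivative_sub,
      Polynomial.derivative_X, Polynomial.eval_add, Polynomial.eval_mul, Polynomial.eval_sub,
      Polynomial.eval_X, Polynomial.eval_C, Polynomial.eval_pow, Polynomial.eval_zero,
      sub_self, zero_mul, mul_zero, add_zero, zero_add] at h1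
    have h2 : z i ≠ 0 := fun h => hw (by rw [← hroot i, h, zero_pow hd])
    exact mul_ne_zero hd1 (mul_ne_zero (by exact_mod_cast hd) (pow_ne_zero (d - 1) h2)) h1
  have hval : ∀ j, criticalValues z lam j = z j * (d / (d + 1)) := fun j => by
    rw [criticalValues, hM, pow_succ, hroot]
    field_simp
    ring
  have hdd : (d / (d + 1) : ℂ) ≠ 0 := div_ne_zero (by exact_mod_cast hd) hd1
  rw [stokesForm_apply, hval, hval, hval, hval] at he
  refine add_ne_add_of_pow_eq hodd hw (hroot (e 0)) (hroot (e 1)) (hroot (e 2)) (hroot (e 3))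
    (fun h => ?_) (fun h => ?_) (mul_right_cancel₀ hdd (by linear_combination he))
  · exact absurd (e.injective (hinj h)) (by decide)
  · exact absurd (e.injective (hinj h)) (by decide)
end

/-! ### The equation does not vanish on the caustic -/

section
variable {d : ℕ}

/-- The translation of the configuration `y` to the centre of mass zero. -/
noncomputable def center (y : Fin d → ℂ) (j : Fin d) : ℂ := y j - (∑ i, y i) / d

theorem sum_center (hd : d ≠ 0) (y : Fin d → ℂ) : ∑ j, center y j = 0 := by
  have : (d : ℂ) ≠ 0 := by exact_mod_cast hd
  simp only [center, Finset.sum_sub_distrib, Finset.sum_const, Finset.card_univ, Fintype.card_fin,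
    nsmul_eq_mul]
  field_simp
  ring

theorem center_eq_self {y : Fin d → ℂ} (h : ∑ i, y i = 0) : center y = y := by
  funext j
  simp [center, h]

theorem contDiff_center : ContDiff ℂ ⊤ (center (d := d)) := by
  unfold center
  fun_prop

theorem contDiff_vietaParam : ContDiff ℂ ⊤ (vietaParam (d := d)) := by
  refine contDiff_pi.2 fun i => contDiff_const.mul (contDiff_iff_contDiffAt.2 fun y => ?_)
  exact (AnalyticAt.aeval_mvPolynomial (f := fun (y : Fin d → ℂ) j => y j)
    (fun j => (coordForm j).analyticAt y) _).contDiffAt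

/-- The parameter with the critical points `center y` and the free term `c`. -/
noncomputable def centeredParam (c : ℂ) (y : Fin d → ℂ) (i : Fin d) : ℂ :=
  if (i : ℕ) = 0 then c else vietaParam (center y) i

theorem contDiff_centeredParam (c : ℂ) : ContDiff ℂ ⊤ (centeredParam (d := d) c) := by
  rw [contDiff_pi]
  intro i
  unfold centeredParam
  split_ifs
  · exact contDiff_const
  · exact (contDiff_apply ℂ ℂ i).comp (contDiff_vietaParam.comp contDiff_center)

theorem isCriticalConfig_centeredParam (hd : d ≠ 0) (c : ℂ) (y : Fin d → ℂ) :
    IsCriticalConfig (center y) (centeredParam c y) :=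
  (isCriticalConfig_iff hd).2 ⟨sum_center hd y, fun _ hi => if_neg hi⟩

theorem IsCriticalConfig.centeredParam_eq (hd : d ≠ 0) {z lam : Fin d → ℂ}
    (hz : IsCriticalConfig z lam) : centeredParam (lam ⟨0, Nat.pos_of_ne_zero hd⟩) z = lam := by
  obtain ⟨h1, h2⟩ := (isCriticalConfig_iff hd).1 hz
  funext i
  unfold centeredParam
  rw [center_eq_self h1]
  split_ifs with hi
  · exact congrArg lam (Fin.ext hi.symm)
  · exact (h2 i hi).symm

theorem analyticAt_criticalValues {f g : (Fin d → ℂ) → (Fin d → ℂ)} {y : Fin d → ℂ}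
    (hf : ContDiff ℂ ⊤ f) (hg : ContDiff ℂ ⊤ g) :
    AnalyticAt ℂ (fun y => criticalValues (f y) (g y)) y := by
  refine ContDiffAt.analyticAt (ContDiff.contDiffAt (contDiff_pi.2 fun j => ?_))
  have h1 : ∀ j, ContDiff ℂ ⊤ fun y => f y j := fun j => (contDiff_apply ℂ ℂ j).comp hf
  have h2 : ∀ j, ContDiff ℂ ⊤ fun y => g y j := fun j => (contDiff_apply ℂ ℂ j).comp hg
  unfold criticalValues monomialDeformation
  dsimp only
  fun_prop

/-- If the critical points are real, and none of them lies strictly between two real points, then the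
values at these points differ, by Rolle's theorem. Here the points are `0` and `1`, before the
translation of the centre of mass of the critical points `n j` to zero. -/
theorem monomialDeformation_ne_of_noncritical_interval (hd : d ≠ 0) (c : ℂ) (n : Fin d → ℝ)
    (hn : ∀ j, n j ∉ Set.Ioo (0 : ℝ) 1) :
    monomialDeformation d (0 - (∑ i, (n i : ℂ)) / d, centeredParam c fun j => (n j : ℂ)) ≠
      monomialDeformation d (1 - (∑ i, (n i : ℂ)) / d, centeredParam c fun j => (n j : ℂ)) := by
  intro heq
  set y : Fin d → ℂ := fun j => (n j : ℂ) with hy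
  set m : ℂ := (∑ i, (n i : ℂ)) / d with hm
  have hcrit := isCriticalConfig_centeredParam hd c y
  have hder : ∀ x : ℂ, HasDerivAt (fun x : ℂ => monomialDeformation d (x - m, centeredParam c y))
      ((d + 1) * ∏ j, (x - n j)) x := by
    intro x
    have h1 := (monomialPoly (centeredParam c y)).hasDerivAt (x - m)
    rw [hcrit.eval_derivative] at h1
    simp only [eval_monomialPoly] at h1
    have h2 : ∀ j, x - m - center y j = x - n j := fun j => by
      simp only [center, hy, hm]; ring
    simp only [h2] at h1
    exact HasDerivAt.comp_sub_const (f := fun x => monomialDeformation d (x, centeredParam c y))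
      x m h1
  obtain ⟨t, ht, ht0⟩ := exists_hasDerivAt_eq_zero (zero_lt_one' ℝ)
    (f := fun x : ℝ => (monomialDeformation d ((x : ℂ) - m, centeredParam c y)).re)
    (f' := fun x : ℝ => ((d + 1) * ∏ j, ((x : ℂ) - n j)).re)
    (fun x _ => (hder x).real_of_complex.continuousAt.continuousWithinAt)
    (by simp only [Complex.ofReal_zero, Complex.ofReal_one, heq])
    (fun x _ => (hder x).real_of_complex)
  have h3 : ((d + 1) * ∏ j, ((t : ℂ) - n j)) = (((d + 1) * ∏ j, (t - n j) : ℝ) : ℂ) := by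
    push_cast; rfl
  rw [h3, Complex.ofReal_re, mul_eq_zero, Finset.prod_eq_zero_iff] at ht0
  rcases ht0 with h | ⟨j, -, h⟩
  · exact absurd h (by positivity)
  · exact hn j (by rwa [← sub_eq_zero.1 h])

/-- The function `α_a + α_b - α_c - α_f` of the critical points does not vanish identically on the
hyperplane `y i = y j`. Real configurations with values in `{0, 1, 2}` suffice: all four
points at `0, 0, 1, 1`, or else two of them at `2`, which contribute opposite values, and the other
two at `0` and `1`. -/
theorem exists_eq_and_stokesForm_ne_zero (hd : d ≠ 0) (c : ℂ) (e : Fin 4 ↪ Fin d) (i j : Fin d) :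
    ∃ y : Fin d → ℂ, y i = y j ∧
      stokesForm e (criticalValues (center y) (centeredParam c y)) ≠ 0 := by
  have hinj : ∀ {p q : Fin 4}, p ≠ q → e p ≠ e q := fun h h' => h (e.injective h')
  have hside : ((i = e 0 ∨ i = e 1) ↔ (j = e 0 ∨ j = e 1)) → ∃ y : Fin d → ℂ, y i = y j ∧
      stokesForm e (criticalValues (center y) (centeredParam c y)) ≠ 0 := by
    intro hij
    have key := monomialDeformation_ne_of_noncritical_interval hd c
      (fun k => if k = e 0 ∨ k = e 1 then 0 else 1) (fun k => by split_ifs <;> norm_num)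
    refine ⟨fun k => ((if k = e 0 ∨ k = e 1 then 0 else 1 : ℝ) : ℂ), by simp only [hij],
      fun h => key ?_⟩
    rw [stokesForm_apply] at h
    simp only [criticalValues, center] at h
    simp [hinj] at h ⊢
    linear_combination h / 2
  by_cases hA : ∃ p ∈ ({0, 1} : Finset (Fin 4)), e p ≠ i ∧ e p ≠ j
  · by_cases hB : ∃ q ∈ ({2, 3} : Finset (Fin 4)), e q ≠ i ∧ e q ≠ j
    · obtain ⟨p, hp, hpi, hpj⟩ := hA
      obtain ⟨q, hq, hqi, hqj⟩ := hB
      have key := monomialDeformation_ne_of_noncritical_interval hd c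
        (fun k => if k = e p then 0 else if k = e q then 1 else 2) (fun k => by
          split_ifs <;> norm_num)
      refine ⟨fun k => ((if k = e p then 0 else if k = e q then 1 else 2 : ℝ) : ℂ), ?_, fun h => ?_⟩
      · simp [hpi.symm, hpj.symm, hqi.symm, hqj.symm]
      · apply key
        rw [stokesForm_apply] at h
        simp only [criticalValues, center] at h
        fin_cases hp <;> fin_cases hq <;> simp [hinj] at h ⊢ <;> linear_combination h
    · push Not at hB
      refine hside ?_
      have h2 : e 2 = i ∨ e 2 = j := or_iff_not_imp_left.2 (hB 2 (by simp))
      have h3 : e 3 = i ∨ e 3 = j := or_iff_not_imp_left.2 (hB 3 (by simp))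
      rcases h2 with rfl | rfl <;> rcases h3 with h3 | h3 <;>
        first
        | exact absurd h3 (hinj (by decide))
        | subst h3; simp [hinj]
  · push Not at hA
    refine hside ?_
    have h2 : e 0 = i ∨ e 0 = j := or_iff_not_imp_left.2 (hA 0 (by simp))
    have h3 : e 1 = i ∨ e 1 = j := or_iff_not_imp_left.2 (hA 1 (by simp))
    rcases h2 with rfl | rfl <;> rcases h3 with h3 | h3 <;>
        first
        | exact absurd h3 (hinj (by decide))
        | subst h3; simp [hinj]
end

/-! ### The zero set of the equation -/

section
variable {d : ℕ}

/-- The parameters of the functions having four different critical values with `α + α' = β + β'`; all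
critical points in `ℂ` are taken into account. -/
def stokesLocus (d : ℕ) : Set (Fin d → ℂ) :=
  {lam | ∃ z : Fin 4 → ℂ, (∀ i, deriv (fun w => monomialDeformation d (w, lam)) (z i) = 0) ∧
    Function.Injective (fun i => monomialDeformation d (z i, lam)) ∧
    monomialDeformation d (z 0, lam) + monomialDeformation d (z 1, lam) =
      monomialDeformation d (z 2, lam) + monomialDeformation d (z 3, lam)}

theorem stokesEquation_eq_zero_of_mem_closure (hd : d ≠ 0) {lam : Fin d → ℂ}
    (h : lam ∈ closure (stokesLocus d)) : stokesEquation hd lam = 0 := by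
  have hc : Continuous (stokesEquation hd) :=
    continuousOn_univ.1 (analyticOnNhd_stokesEquation hd).continuousOn
  refine (closure_minimal ?_ (isClosed_eq hc continuous_const)) h
  rintro lam ⟨x, hx, hinj, hsum⟩
  obtain ⟨z, hz⟩ := exists_isCriticalConfig lam
  have hσ : ∀ i, ∃ j, z j = x i := fun i =>
    hz.exists_eq (by rw [← deriv_monomialDeformation, hx])
  choose σ hσ using hσ
  have hσi : Function.Injective σ := fun i j hij => hinj (by
    change monomialDeformation d (x i, lam) = monomialDeformation d (x j, lam)
    rw [← hσ, ← hσ, hij])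
  change stokesEquation hd lam = 0
  rw [hz.stokesEquation_eq, stokesProduct_eq_zero_iff]
  refine ⟨⟨σ, hσi⟩, ?_⟩
  simp only [stokesForm_apply, criticalValues, Function.Embedding.coeFn_mk, hσ]
  linear_combination hsum

/-- The zero set of `α_a + α_b - α_c - α_f` has no component on which two critical points coincide. -/
theorem mem_closure_distinct_of_stokesForm_eq_zero (hd : d ≠ 0) {z lam : Fin d → ℂ}
    (hz : IsCriticalConfig z lam) {e : Fin 4 ↪ Fin d}
    (he : stokesForm e (criticalValues z lam) = 0) :
    lam ∈ closure {mu | ∃ w, IsCriticalConfig w mu ∧ Function.Injective w ∧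
      stokesForm e (criticalValues w mu) = 0} := by
  set c := lam ⟨0, Nat.pos_of_ne_zero hd⟩ with hc
  have hlam : centeredParam c z = lam := hz.centeredParam_eq hd
  have hcz : center z = z := center_eq_self ((isCriticalConfig_iff hd).1 hz).1
  obtain ⟨w₀, -, hw₀⟩ := exists_eq_and_stokesForm_ne_zero hd c e (e 0) (e 1)
  have hmain := zeros_subset_closure_diff_hyperplanes
    (P := fun y => stokesForm e (criticalValues (center y) (centeredParam c y)))
    (fun y _ => ((stokesForm e).analyticAt _).comp
      (analyticAt_criticalValues contDiff_center (contDiff_centeredParam c)))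
    hw₀ (fun p : {p : Fin d × Fin d // p.1 ≠ p.2} => coordForm p.1.1 - coordForm p.1.2)
    (fun ⟨p, hp⟩ h => by
      have := DFunLike.congr_fun h (Pi.single p.1 1)
      change Pi.single (M := fun _ => ℂ) p.1 1 p.1 - Pi.single (M := fun _ => ℂ) p.1 1 p.2 = 0
        at this
      simp [hp.symm] at this)
    (fun ⟨p, hp⟩ => by
      obtain ⟨y, hy, hy'⟩ := exists_eq_and_stokesForm_ne_zero hd c e p.1 p.2
      exact ⟨y, sub_eq_zero.2 hy, hy'⟩)
    (z := z) (by simp only [hlam, hcz, he])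
  rw [← hlam]
  refine map_mem_closure (contDiff_centeredParam c).continuous hmain ?_
  rintro y ⟨hy0, hy⟩
  refine ⟨center y, isCriticalConfig_centeredParam hd c y, fun i j hij => ?_, hy0⟩
  by_contra hne
  exact hy ⟨(i, j), hne⟩ (sub_eq_zero.2 (by simpa [center] using hij))

/-- The derivative in `z` of the monomial deformation. -/
noncomputable def criticalDeriv (d : ℕ) (p : ℂ × (Fin d → ℂ)) : ℂ :=
  (monomialPoly p.2).derivative.eval p.1

theorem criticalDeriv_eq (p : ℂ × (Fin d → ℂ)) :
    criticalDeriv d p = (d + 1) * p.1 ^ d + ∑ i : Fin d, p.2 i * ((i : ℕ) * p.1 ^ (i - 1 : ℕ)) := by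
  simp [criticalDeriv, monomialPoly, Polynomial.eval_finsetSum, Polynomial.derivative_X_pow]

theorem contDiff_criticalDeriv : ContDiff ℂ ⊤ (criticalDeriv d) := by
  simp only [funext criticalDeriv_eq]
  fun_prop

theorem contDiff_monomialDeformation : ContDiff ℂ ⊤ (monomialDeformation d) := by
  unfold monomialDeformation
  fun_prop

/-- The map `(λ, x) ↦ (f_λ (x_j), f_λ' (x_j))`. Its inverse over the points `(β, 0)` expresses the
parameters through the critical values. -/
noncomputable def criticalMap (d : ℕ) (p : (Fin d → ℂ) × (Fin d → ℂ)) :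
    (Fin d → ℂ) × (Fin d → ℂ) :=
  (fun j => monomialDeformation d (p.2 j, p.1), fun j => criticalDeriv d (p.2 j, p.1))

/-- The linear map `(λ, x) ↦ (x_j, λ)`. -/
noncomputable def pairAt (j : Fin d) : (Fin d → ℂ) × (Fin d → ℂ) →L[ℂ] ℂ × (Fin d → ℂ) :=
  ((coordForm j).comp (ContinuousLinearMap.snd ℂ _ _)).prod (ContinuousLinearMap.fst ℂ _ _)

theorem contDiff_criticalMap : ContDiff ℂ ⊤ (criticalMap d) := by
  refine ContDiff.prodMk (contDiff_pi.2 fun j => ?_) (contDiff_pi.2 fun j => ?_)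
  · exact contDiff_monomialDeformation.comp (pairAt j).contDiff
  · exact contDiff_criticalDeriv.comp (pairAt j).contDiff

theorem fderiv_apply_fst {V : Type*} [NormedAddCommGroup V] [NormedSpace ℂ V] {Q : ℂ × V → ℂ}
    {x : ℂ} {v : V} (hQ : DifferentiableAt ℂ Q (x, v)) {c : ℂ}
    (hc : HasDerivAt (fun t => Q (t, v)) c x) (ξ : ℂ) : fderiv ℂ Q (x, v) (ξ, 0) = ξ * c := by
  have h1 : HasFDerivAt (fun t => Q (t, v)) ((fderiv ℂ Q (x, v)).comp
      (ContinuousLinearMap.inl ℂ ℂ V)) x :=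
    HasFDerivAt.comp (g := Q) (f := fun t => (t, v)) x hQ.hasFDerivAt (hasFDerivAt_prodMk_left x v)
  have h2 := DFunLike.congr_fun (h1.unique hc.hasFDerivAt) ξ
  simpa using h2

theorem fderiv_monomialDeformation_apply (x : ℂ) (lam : Fin d → ℂ) (ξ : ℂ) (δ : Fin d → ℂ) :
    fderiv ℂ (monomialDeformation d) (x, lam) (ξ, δ) =
      ξ * criticalDeriv d (x, lam) + ∑ i : Fin d, x ^ (i : ℕ) * δ i := by
  have hM : DifferentiableAt ℂ (monomialDeformation d) (x, lam) :=
    (contDiff_monomialDeformation.differentiable (by simp)) _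
  have hsplit : ((ξ, δ) : ℂ × (Fin d → ℂ)) = (ξ, 0) + (0, δ) := by simp
  rw [hsplit, map_add]
  congr 1
  · refine fderiv_apply_fst hM ?_ ξ
    simp only [← eval_monomialPoly]
    exact (monomialPoly lam).hasDerivAt x
  · have h1 : HasFDerivAt (fun mu => monomialDeformation d (x, mu))
        ((fderiv ℂ (monomialDeformation d) (x, lam)).comp
          (ContinuousLinearMap.inr ℂ ℂ (Fin d → ℂ))) lam :=
      HasFDerivAt.comp (g := monomialDeformation d) (f := fun mu => (x, mu)) lam hM.hasFDerivAt
        (hasFDerivAt_prodMk_right x lam)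
    have h2 : HasFDerivAt (fun mu : Fin d → ℂ => monomialDeformation d (x, mu))
        (∑ i : Fin d, (x ^ (i : ℕ)) • coordForm i) lam := by
      refine HasFDerivAt.const_add (x ^ (d + 1)) (HasFDerivAt.fun_sum fun i _ => ?_)
      exact (coordForm i).hasFDerivAt.mul_const (x ^ (i : ℕ))
    have h3 := DFunLike.congr_fun (h1.unique h2) δ
    simpa using h3

theorem IsCriticalConfig.eval_derivative_derivative_ne_zero {z lam : Fin d → ℂ}
    (hz : IsCriticalConfig z lam) (hinj : Function.Injective z) (j : Fin d) :
    (monomialPoly lam).derivative.derivative.eval (z j) ≠ 0 := by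
  rw [hz, ← Finset.mul_prod_erase _ _ (Finset.mem_univ j)]
  simp only [Polynomial.derivative_mul, Polynomial.derivative_C, Polynomial.derivative_sub,
    Polynomial.derivative_X, Polynomial.eval_add, Polynomial.eval_mul, Polynomial.eval_sub,
    Polynomial.eval_X, Polynomial.eval_C, sub_self, sub_zero, zero_mul, one_mul,
    add_zero, zero_add, Polynomial.eval_prod]
  refine mul_ne_zero (by exact_mod_cast d.succ_ne_zero) (Finset.prod_ne_zero_iff.2 fun i hi => ?_)
  exact sub_ne_zero.2 fun h => (Finset.mem_erase.1 hi).1 (hinj h.symm)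

/-- If all the critical points are distinct, the critical values are local coordinates on the parameter
space: a polynomial of degree less than `d` is determined by its values at `d` distinct points. -/
theorem injective_fderiv_criticalMap {z lam : Fin d → ℂ} (hz : IsCriticalConfig z lam)
    (hinj : Function.Injective z) : Function.Injective (fderiv ℂ (criticalMap d) (lam, z)) := by
  have hM : ∀ j, DifferentiableAt ℂ (monomialDeformation d) (z j, lam) := fun j =>
    (contDiff_monomialDeformation.differentiable (by simp)) _
  have hD : ∀ j, DifferentiableAt ℂ (criticalDeriv d) (z j, lam) := fun j =>
    (contDiff_criticalDeriv.differentiable (by simp)) _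
  have hf : HasFDerivAt (criticalMap d)
      ((ContinuousLinearMap.pi fun j =>
          (fderiv ℂ (monomialDeformation d) (z j, lam)).comp (pairAt j)).prod
        (ContinuousLinearMap.pi fun j =>
          (fderiv ℂ (criticalDeriv d) (z j, lam)).comp (pairAt j))) (lam, z) := by
    refine HasFDerivAt.prodMk (hasFDerivAt_pi.2 fun j => ?_) (hasFDerivAt_pi.2 fun j => ?_)
    · exact HasFDerivAt.comp (g := monomialDeformation d) (f := pairAt j) (lam, z)
        (hM j).hasFDerivAt (pairAt j).hasFDerivAt
    · exact HasFDerivAt.comp (g := criticalDeriv d) (f := pairAt j) (lam, z)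
        (hD j).hasFDerivAt (pairAt j).hasFDerivAt
  rw [hf.fderiv, injective_iff_map_eq_zero]
  rintro ⟨δ, ξ⟩ h0
  have h1 : ∀ j, fderiv ℂ (monomialDeformation d) (z j, lam) (ξ j, δ) = 0 := fun j =>
    congrFun (congrArg Prod.fst h0) j
  have h2 : ∀ j, fderiv ℂ (criticalDeriv d) (z j, lam) (ξ j, δ) = 0 := fun j =>
    congrFun (congrArg Prod.snd h0) j
  have hcd : ∀ j, criticalDeriv d (z j, lam) = 0 := fun j => hz.eval_eq_zero j
  simp only [fderiv_monomialDeformation_apply, hcd, mul_zero, zero_add] at h1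
  have hδ : δ = 0 := Matrix.eq_zero_of_forall_index_sum_pow_mul_eq_zero hinj h1
  subst hδ
  refine Prod.ext rfl (funext fun j => ?_)
  have h3 := h2 j
  rw [fderiv_apply_fst (hD j) ((monomialPoly lam).derivative.hasDerivAt (z j))] at h3
  exact (mul_eq_zero.1 h3).resolve_right (hz.eval_derivative_derivative_ne_zero hinj j)

/-- In the local coordinates given by the critical values, `stokesEquation` is `stokesProduct`. -/
theorem mem_closure_regular_of_distinct (hd : d ≠ 0) {z lam : Fin d → ℂ}
    (hz : IsCriticalConfig z lam) (hinj : Function.Injective z) {e : Fin 4 ↪ Fin d}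
    (he : stokesForm e (criticalValues z lam) = 0) :
    lam ∈ closure {mu | mu ∈ stokesLocus d ∧ stokesEquation hd mu = 0 ∧
      fderiv ℂ (stokesEquation hd) mu ≠ 0} := by
  have hI := injective_fderiv_criticalMap hz hinj
  set A := fderiv ℂ (criticalMap d) (lam, z) with hA
  let A' : ((Fin d → ℂ) × (Fin d → ℂ)) ≃L[ℂ] ((Fin d → ℂ) × (Fin d → ℂ)) :=
    ContinuousLinearEquiv.ofBijective A (LinearMap.ker_eq_bot.2 hI)
      (LinearMap.range_eq_top.2 (LinearMap.injective_iff_surjective.1 hI))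
  have hC : ContDiffAt ℂ ⊤ (criticalMap d) (lam, z) := contDiff_criticalMap.contDiffAt
  have hD : HasFDerivAt (criticalMap d) (A' : _ →L[ℂ] _) (lam, z) :=
    (hC.differentiableAt (by simp)).hasFDerivAt
  let I := hC.localInverse hD (by simp)
  set α := criticalValues z lam with hα
  have hbase : criticalMap d (lam, z) = (α, 0) :=
    Prod.ext rfl (funext fun j => hz.eval_eq_zero j)
  have hIa : I (α, 0) = (lam, z) := by
    rw [← hbase]; exact hC.localInverse_apply_image hD (by simp)
  have hIC : AnalyticAt ℂ I (α, 0) := by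
    rw [← hbase]; exact (hC.to_localInverse hD (by simp)).analyticAt
  have hIr : ∀ᶠ y in 𝓝 (α, (0 : Fin d → ℂ)), criticalMap d (I y) = y := by
    rw [← hbase]; exact (hC.hasStrictFDerivAt' hD (by simp)).eventually_right_inverse
  let J : (Fin d → ℂ) → (Fin d → ℂ) × (Fin d → ℂ) := fun β => I (β, 0)
  have hJa : J α = (lam, z) := hIa
  have hJC : AnalyticAt ℂ J α :=
    AnalyticAt.comp (g := I) (f := fun β => (β, (0 : Fin d → ℂ))) hIC
      (analyticAt_id.prod analyticAt_const)
  have hJr : ∀ᶠ β in 𝓝 α, criticalMap d (J β) = (β, 0) :=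
    (Continuous.tendsto (by fun_prop : Continuous fun β => (β, (0 : Fin d → ℂ))) α).eventually hIr
  have hJt : Tendsto J (𝓝 α) (𝓝 (lam, z)) := hJa ▸ hJC.continuousAt.tendsto
  have hJinj : ∀ᶠ β in 𝓝 α, Function.Injective (J β).2 := by
    have h1 : ∀ p : Fin d × Fin d, p.1 ≠ p.2 → ∀ᶠ β in 𝓝 α, (J β).2 p.1 ≠ (J β).2 p.2 := by
      intro p hp
      have h2 : ∀ j, Tendsto (fun β => (J β).2 j) (𝓝 α) (𝓝 (z j)) := fun j =>
        (Continuous.tendsto (by fun_prop : Continuous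
          fun q : (Fin d → ℂ) × (Fin d → ℂ) => q.2 j) (lam, z)).comp hJt
      exact (((h2 p.1).sub (h2 p.2)).eventually_ne (sub_ne_zero.2 fun h => hp (hinj h))).mono
        fun _ h => sub_ne_zero.1 h
    have h3 : ∀ᶠ β in 𝓝 α, ∀ p : Fin d × Fin d, p.1 ≠ p.2 → (J β).2 p.1 ≠ (J β).2 p.2 :=
      eventually_all.2 fun p => by
        by_cases hp : p.1 = p.2
        · exact Eventually.of_forall fun _ h => absurd hp h
        · exact (h1 p hp).mono fun _ h _ => h
    filter_upwards [h3] with β h i j hij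
    by_contra hne
    exact h (i, j) hne hij
  have hcfg : ∀ᶠ β in 𝓝 α, IsCriticalConfig (J β).2 (J β).1 ∧
      criticalValues (J β).2 (J β).1 = β := by
    filter_upwards [hJr, hJinj] with β h1 h2
    exact ⟨isCriticalConfig_of_injective h2 fun j => congrFun (congrArg Prod.snd h1) j,
      congrArg Prod.fst h1⟩
  have heq : ∀ᶠ β in 𝓝 α, stokesEquation hd (J β).1 = stokesProduct β := by
    filter_upwards [hcfg] with β h
    rw [h.1.stokesEquation_eq, h.2]
  have hfreq := mem_closure_iff_frequently.1 (mem_closure_generic_of_stokesForm_eq_zero he)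
  have hev := (hcfg.and (heq.eventually_nhds.and hJC.eventually_analyticAt))
  have hJ1 : Tendsto (fun β => (J β).1) (𝓝 α) (𝓝 lam) :=
    (continuous_fst.tendsto (lam, z)).comp hJt
  refine mem_closure_iff_frequently.2 (hJ1.frequently ((hfreq.and_eventually hev).mono ?_))
  rintro β ⟨⟨h0, hβinj, hβd, hβ⟩, ⟨hcrit, hval⟩, heqβ, hJβ⟩
  refine ⟨⟨fun i => (J β).2 (e i), fun i => ?_, ?_, ?_⟩, ?_, fun hzero => hβ ?_⟩
  · rw [deriv_monomialDeformation]
    exact hcrit.eval_eq_zero _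
  · have : (fun i => monomialDeformation d ((J β).2 (e i), (J β).1)) = fun i => β (e i) :=
      funext fun i => congrFun hval (e i)
    rw [this]
    exact hβinj.comp e.injective
  · have h1 : ∀ j, monomialDeformation d ((J β).2 j, (J β).1) = β j := congrFun hval
    simp only [h1]
    rw [stokesForm_apply] at h0
    linear_combination h0
  · rw [heqβ.self_of_nhds, stokesProduct_eq_zero_iff]
    exact ⟨e, h0⟩
  · have h1 : HasFDerivAt (stokesEquation hd) (0 : (Fin d → ℂ) →L[ℂ] ℂ) (J β).1 := by
      rw [← hzero]
      exact ((analyticOnNhd_stokesEquation hd) _ (Set.mem_univ _)).differentiableAt.hasFDerivAt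
    have h2 : HasFDerivAt (fun β => stokesEquation hd (J β).1) (0 : (Fin d → ℂ) →L[ℂ] ℂ) β := by
      have := HasFDerivAt.comp (g := stokesEquation hd) (f := fun β => (J β).1) β h1
        hJβ.differentiableAt.fst.hasFDerivAt
      rwa [ContinuousLinearMap.zero_comp] at this
    exact (h2.congr_of_eventuallyEq (heqβ.mono fun _ h => h.symm)).fderiv

theorem mem_closure_regular_of_stokesEquation_eq_zero (hd : d ≠ 0) {lam : Fin d → ℂ}
    (h : stokesEquation hd lam = 0) :
    lam ∈ closure {mu | mu ∈ stokesLocus d ∧ stokesEquation hd mu = 0 ∧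
      fderiv ℂ (stokesEquation hd) mu ≠ 0} := by
  obtain ⟨z, hz⟩ := exists_isCriticalConfig lam
  rw [hz.stokesEquation_eq, stokesProduct_eq_zero_iff] at h
  obtain ⟨e, he⟩ := h
  refine closure_minimal ?_ isClosed_closure (mem_closure_distinct_of_stokesForm_eq_zero hd hz he)
  rintro mu ⟨w, hw, hinj, hew⟩
  exact mem_closure_regular_of_distinct hd hw hinj hew
end

/-! ### Pull-back by a submersion -/

section
variable {d k : ℕ}

theorem eventually_surjective_fderiv {θ : (Fin k → ℂ) → (Fin d → ℂ)} (hθ : AnalyticAt ℂ θ 0)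
    {L : (Fin d → ℂ) →L[ℂ] (Fin k → ℂ)} (hL : ∀ v, fderiv ℂ θ 0 (L v) = v) :
    ∀ᶠ s in 𝓝 (0 : Fin k → ℂ), Function.Surjective (fderiv ℂ θ s) := by
  have h1 : ContinuousAt (fun s => (fderiv ℂ θ s).comp L) 0 :=
    hθ.fderiv.continuousAt.clm_comp continuousAt_const
  have h2 : (fderiv ℂ θ 0).comp L = 1 := ContinuousLinearMap.ext hL
  have h3 : {A : (Fin d → ℂ) →L[ℂ] (Fin d → ℂ) | IsUnit A} ∈ 𝓝 ((fderiv ℂ θ 0).comp L) := by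
    rw [h2]
    exact Units.isOpen.mem_nhds isUnit_one
  filter_upwards [h1.eventually_mem h3] with s hs v
  obtain ⟨u, hu⟩ := hs
  refine ⟨L ((↑u⁻¹ : (Fin d → ℂ) →L[ℂ] (Fin d → ℂ)) v), ?_⟩
  have h4 := DFunLike.congr_fun u.mul_inv v
  rw [hu] at h4
  exact h4

theorem map_nhds_eq_of_surjective_fderiv {θ : (Fin k → ℂ) → (Fin d → ℂ)} {s : Fin k → ℂ}
    (hθ : AnalyticAt ℂ θ s) (hs : Function.Surjective (fderiv ℂ θ s)) :
    map θ (𝓝 s) = 𝓝 (θ s) :=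
  hθ.hasStrictFDerivAt.map_nhds_eq_of_surj (LinearMap.range_eq_top.2 hs)

/-- A submersion pulls the reduced equation back to a reduced equation. -/
theorem isReducedLocalEquation_comp (hd : d ≠ 0) {X : Set (Fin k → ℂ)}
    {θ : (Fin k → ℂ) → (Fin d → ℂ)} (hθ : AnalyticAt ℂ θ 0)
    {L : (Fin d → ℂ) →L[ℂ] (Fin k → ℂ)} (hL : ∀ v, fderiv ℂ θ 0 (L v) = v)
    (hX : ∀ᶠ s in 𝓝 0, s ∈ X ↔ θ s ∈ stokesLocus d) :
    IsReducedLocalEquation (fun s => stokesEquation hd (θ s)) (closure X) := by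
  have hopen : ∀ᶠ s in 𝓝 (0 : Fin k → ℂ), map θ (𝓝 s) = 𝓝 (θ s) := by
    filter_upwards [hθ.eventually_analyticAt, eventually_surjective_fderiv hθ hL] with s h1 h2
    exact map_nhds_eq_of_surjective_fderiv h1 h2
  refine ⟨((analyticOnNhd_stokesEquation hd) _ (Set.mem_univ _)).comp hθ, ?_, ?_⟩
  · filter_upwards [hopen, hX.eventually_nhds] with s h1 h2
    have h3 : s ∈ closure X ↔ θ s ∈ closure (stokesLocus d) := by
      rw [mem_closure_iff_frequently, mem_closure_iff_frequently, ← h1, frequently_map]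
      exact frequently_congr h2
    rw [h3]
    refine ⟨stokesEquation_eq_zero_of_mem_closure hd, fun h => closure_mono (fun _ h => h.1)
      (mem_closure_regular_of_stokesEquation_eq_zero hd h)⟩
  · filter_upwards [hopen, (hθ.eventually_analyticAt.and
      (eventually_surjective_fderiv hθ hL)).eventually_nhds] with s h1 h2 h3
    have h4 := mem_closure_regular_of_stokesEquation_eq_zero hd h3
    rw [mem_closure_iff_frequently, ← h1, frequently_map] at h4
    refine mem_closure_iff_frequently.2 ((h4.and_eventually h2).mono ?_)
    rintro y ⟨⟨-, hy0, hy1⟩, hya, hys⟩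
    refine ⟨hy0, fun hzero => hy1 (ContinuousLinearMap.ext fun w => ?_)⟩
    obtain ⟨v, rfl⟩ := hys w
    have h5 := fderiv_comp y (g := stokesEquation hd) (f := θ)
      ((analyticOnNhd_stokesEquation hd) _ (Set.mem_univ _)).differentiableAt hya.differentiableAt
    exact DFunLike.congr_fun (h5.symm.trans hzero) v

/-- By quasihomogeneity, the order on every line is at least `m`, because the largest weight, `d`,
belongs to `λ_1`, and the order is `m` on the lines that `θ` maps to curves tangent to the `λ_1`-axis. -/
theorem degreeAtZero_comp (hd : d ≠ 0) (hodd : Odd d) {m : ℕ}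
    (hm : d * m = (d + 1) * (3 * d.choose 4))
    {θ : (Fin k → ℂ) → (Fin d → ℂ)} (hθ : AnalyticAt ℂ θ 0) (hθ0 : θ 0 = 0)
    {L : (Fin d → ℂ) →L[ℂ] (Fin k → ℂ)} (hL : ∀ v, fderiv ℂ θ 0 (L v) = v) :
    degreeAtZero (fun s => stokesEquation hd (θ s)) = m := by
  have hc : Continuous (stokesEquation hd) :=
    continuousOn_univ.1 (analyticOnNhd_stokesEquation hd).continuousOn
  have key : ∀ v : Fin k → ℂ,
      (m : ℕ∞) ≤ analyticOrderAt (fun t : ℂ => stokesEquation hd (θ (t • v))) 0 ∧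
      (stokesEquation hd (fun i => if (i : ℕ) = 0 then 0 else
        0 ^ (i - 1 : ℕ) * fderiv ℂ θ 0 v i) ≠ 0 →
      analyticOrderAt (fun t : ℂ => stokesEquation hd (θ (t • v))) 0 = m) := by
    intro v
    have hline : AnalyticAt ℂ (fun t : ℂ => θ (t • v)) 0 := by
      refine AnalyticAt.fun_comp (g := θ) (f := fun t : ℂ => t • v) ?_
        (analyticAt_id.smul analyticAt_const)
      simpa using hθ
    have hder : HasDerivAt (fun t : ℂ => θ (t • v)) (fderiv ℂ θ 0 v) 0 := by
      have h1 : HasFDerivAt θ (fderiv ℂ θ 0) ((0 : ℂ) • v) := by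
        rw [zero_smul]; exact hθ.differentiableAt.hasFDerivAt
      have h2 : HasDerivAt (fun t : ℂ => t • v) v 0 := by
        simpa using (hasDerivAt_id (0 : ℂ)).smul_const v
      exact h1.comp_hasDerivAt 0 h2
    have hpow : Tendsto (fun c : ℂ => c ^ d) (𝓝[≠] 0) (𝓝[≠] 0) := by
      refine tendsto_nhdsWithin_iff.2 ⟨?_, ?_⟩
      · have : Tendsto (fun c : ℂ => c ^ d) (𝓝[≠] 0) (𝓝 (0 ^ d)) :=
          ((continuous_pow d).tendsto _).mono_left nhdsWithin_le_nhds
        rwa [zero_pow hd] at this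
      · filter_upwards [self_mem_nhdsWithin] with c hc
        exact pow_ne_zero _ hc
    have hslope : Tendsto (fun c : ℂ => (c ^ d)⁻¹ • θ ((c ^ d) • v)) (𝓝[≠] 0)
        (𝓝 (fderiv ℂ θ 0 v)) := by
      have := (hasDerivAt_iff_tendsto_slope_zero.1 hder).comp hpow
      simpa [Function.comp_def, hθ0] using this
    -- `θ (c ^ d • v)` rescaled by the weights `d + 1 - i`; the free term, on which `stokesEquation`
    -- does not depend, is replaced by `0`, since its rescaling by `c ^ (d + 1)` need not converge.
    let μ : ℂ → Fin d → ℂ := fun c i =>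
      if (i : ℕ) = 0 then 0 else c ^ (i - 1 : ℕ) * ((c ^ d)⁻¹ • θ ((c ^ d) • v)) i
    have hμ : Tendsto μ (𝓝[≠] 0) (𝓝 (fun i => if (i : ℕ) = 0 then 0 else
        0 ^ (i - 1 : ℕ) * fderiv ℂ θ 0 v i)) := by
      refine tendsto_pi_nhds.2 fun i => ?_
      simp only [μ]
      split_ifs
      · exact tendsto_const_nhds
      · exact (((continuous_pow _).tendsto _).mono_left nhdsWithin_le_nhds).mul
          (tendsto_pi_nhds.1 hslope i)
    refine le_analyticOrderAt_of_comp_pow (u := fun c => stokesEquation hd (μ c)) hd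
      (((analyticOnNhd_stokesEquation hd) _ (Set.mem_univ _)).fun_comp hline) ?_
      ((hc.tendsto _).comp hμ)
    filter_upwards [self_mem_nhdsWithin] with c hc
    have hc : c ≠ 0 := hc
    rw [hm]
    refine stokesEquation_scale hd fun i hi => ?_
    simp only [μ, if_neg hi, Pi.smul_apply, smul_eq_mul]
    have : c ^ d = c ^ (d + 1 - i : ℕ) * c ^ (i - 1 : ℕ) := by
      rw [← pow_add]; congr 1; have := i.2; omega
    rw [← mul_assoc, ← this, mul_inv_cancel_left₀ (pow_ne_zero _ hc)]
  refine le_antisymm ?_ (le_iInf fun v => (key v).1)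
  refine (iInf_le _ (L fun i => if (i : ℕ) = 1 then 1 else 0)).trans ((key _).2 ?_).le
  rw [hL]
  convert stokesEquation_ne_zero hd hodd using 3 with i
  rcases Nat.lt_trichotomy (i : ℕ) 1 with h | h | h
  · simp [Nat.lt_one_iff.1 h]
  · simp [h]
  · simp [h.ne']

/-- For small parameters, all critical points are close to the origin. -/
theorem eventually_norm_lt_of_criticalDeriv_eq_zero {δ : ℝ} (hδ : 0 < δ) :
    ∀ᶠ lam in 𝓝 (0 : Fin d → ℂ), ∀ x, criticalDeriv d (x, lam) = 0 → ‖x‖ < δ := by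
  have hc : Continuous fun lam : Fin d → ℂ =>
      ∑ i : Fin d, ‖lam i‖ * ((i : ℕ) * δ⁻¹ ^ (d + 1 - i : ℕ)) := by fun_prop
  have hlt : ∀ᶠ lam in 𝓝 (0 : Fin d → ℂ),
      ∑ i : Fin d, ‖lam i‖ * ((i : ℕ) * δ⁻¹ ^ (d + 1 - i : ℕ)) < 1 :=
    (hc.tendsto 0).eventually_lt_const (by simp)
  filter_upwards [hlt] with lam hlam x hx
  by_contra! hxδ
  have hxpos : 0 < ‖x‖ := hδ.trans_le hxδ
  rw [criticalDeriv_eq] at hx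
  simp only at hx
  have h1 : ‖(d + 1 : ℂ) * x ^ d‖ = (d + 1) * ‖x‖ ^ d := by
    rw [norm_mul, norm_pow]
    congr 1
    exact_mod_cast Complex.norm_natCast (d + 1)
  have h2 : ‖(d + 1 : ℂ) * x ^ d‖ ≤
      (∑ i : Fin d, ‖lam i‖ * ((i : ℕ) * δ⁻¹ ^ (d + 1 - i : ℕ))) * ‖x‖ ^ d := by
    rw [eq_neg_of_add_eq_zero_left hx, norm_neg, Finset.sum_mul]
    refine (norm_sum_le _ _).trans (Finset.sum_le_sum fun i _ => ?_)
    rw [norm_mul, norm_mul, norm_pow, Complex.norm_natCast, mul_assoc, mul_assoc]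
    refine mul_le_mul_of_nonneg_left ?_ (norm_nonneg _)
    by_cases hi : (i : ℕ) = 0
    · simp [hi]
    refine mul_le_mul_of_nonneg_left ?_ (Nat.cast_nonneg _)
    have h3 : ‖x‖ ^ d = ‖x‖ ^ (d + 1 - i : ℕ) * ‖x‖ ^ (i - 1 : ℕ) := by
      rw [← pow_add]; congr 1; have := i.2; omega
    rw [h3, ← mul_assoc, ← mul_pow]
    refine le_mul_of_one_le_left (by positivity) (one_le_pow₀ ?_)
    rw [inv_mul_eq_div, one_le_div hδ]
    exact hxδ
  rw [h1] at h2
  have h3 := le_of_mul_le_mul_right h2 (pow_pos hxpos d)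
  have : (0 : ℝ) ≤ d := Nat.cast_nonneg d
  linarith

end

/-! ### Critical points in a small disc, and the multiplicity -/

section
variable {d k : ℕ}

/-- The set whose closure is `pureStokesSet F r`. -/
def pureStokesLocus (F : ℂ × (Fin k → ℂ) → ℂ) (r : ℝ) : Set (Fin k → ℂ) :=
  {lam | ∃ z : Fin 4 → ℂ,
    (∀ i, z i ∈ Metric.ball (0 : ℂ) r ∧ deriv (fun w => F (w, lam)) (z i) = 0) ∧
    Function.Injective (fun i => F (z i, lam)) ∧
    F (z 0, lam) + F (z 1, lam) = F (z 2, lam) + F (z 3, lam)}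

/-- If `F (·, s)` is `f_lam ∘ g` with `g` locally biholomorphic on the disc and onto the critical points
of `f_lam`, then `F (·, s)` and `f_lam` have the same critical values. -/
theorem mem_pureStokesLocus_iff {F : ℂ × (Fin k → ℂ) → ℂ} {r : ℝ} {s : Fin k → ℂ}
    {lam : Fin d → ℂ} {g : ℂ → ℂ}
    (hF : ∀ w ∈ Metric.ball (0 : ℂ) r, F (w, s) = monomialDeformation d (g w, lam))
    (hg : ∀ w ∈ Metric.ball (0 : ℂ) r, DifferentiableAt ℂ g w)
    (hg' : ∀ w ∈ Metric.ball (0 : ℂ) r, deriv g w ≠ 0)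
    (hsurj : ∀ x, criticalDeriv d (x, lam) = 0 → ∃ w ∈ Metric.ball (0 : ℂ) r, g w = x) :
    s ∈ pureStokesLocus F r ↔ lam ∈ stokesLocus d := by
  have hder : ∀ w ∈ Metric.ball (0 : ℂ) r,
      deriv (fun w => F (w, s)) w = criticalDeriv d (g w, lam) * deriv g w := by
    intro w hw
    have h1 : (fun w => F (w, s)) =ᶠ[𝓝 w] fun w => monomialDeformation d (g w, lam) :=
      (Metric.isOpen_ball.eventually_mem hw).mono hF
    rw [h1.deriv_eq]
    have h2 : HasDerivAt (fun x => monomialDeformation d (x, lam)) (criticalDeriv d (g w, lam))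
        (g w) := by
      simp only [← eval_monomialPoly]
      exact (monomialPoly lam).hasDerivAt (g w)
    exact (HasDerivAt.comp w h2 (hg w hw).hasDerivAt).deriv
  constructor
  · rintro ⟨z, hz, hinj, hsum⟩
    have hval : ∀ i, F (z i, s) = monomialDeformation d (g (z i), lam) := fun i => hF _ (hz i).1
    simp only [hval] at hinj hsum
    refine ⟨fun i => g (z i), fun i => ?_, hinj, hsum⟩
    rw [deriv_monomialDeformation]
    have := hder _ (hz i).1
    rw [(hz i).2] at this
    exact (mul_eq_zero.1 this.symm).resolve_right (hg' _ (hz i).1)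
  · rintro ⟨x, hx, hinj, hsum⟩
    have hcrit : ∀ i, criticalDeriv d (x i, lam) = 0 := fun i => by
      rw [← hx i, deriv_monomialDeformation]; rfl
    choose z hz hzx using fun i => hsurj (x i) (hcrit i)
    have hval : ∀ i, F (z i, s) = monomialDeformation d (x i, lam) := fun i => by
      rw [hF _ (hz i), hzx]
    refine ⟨z, fun i => ⟨hz i, ?_⟩, ?_, ?_⟩
    · rw [hder _ (hz i), hzx, hcrit, zero_mul]
    · simpa only [hval] using hinj
    · simpa only [hval] using hsum

/-- The multiplicity is the same for a deformation induced from the monomial one by a submersion `θ`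
of the parameters. A right inverse `L` of the differential of `θ` witnesses the submersivity. -/
theorem hasPureStokesMultiplicity_of_induced (hodd : Odd d) {m : ℕ}
    (hm : d * m = (d + 1) * (3 * d.choose 4)) {F : ℂ × (Fin k → ℂ) → ℂ}
    {θ : (Fin k → ℂ) → (Fin d → ℂ)} (hθ : AnalyticAt ℂ θ 0) (hθ0 : θ 0 = 0)
    {L : (Fin d → ℂ) →L[ℂ] (Fin k → ℂ)} (hL : ∀ v, fderiv ℂ θ 0 (L v) = v)
    (hF : ∀ᶠ r : ℝ in 𝓝[>] 0, ∀ᶠ s in 𝓝 0, s ∈ pureStokesLocus F r ↔ θ s ∈ stokesLocus d) :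
    HasPureStokesMultiplicity F m := by
  have hd : d ≠ 0 := hodd.pos.ne'
  filter_upwards [hF] with r hr
  exact ⟨_, isReducedLocalEquation_comp hd hθ hL hr, degreeAtZero_comp hd hodd hm hθ hθ0 hL⟩

theorem hasPureStokesMultiplicity_monomialDeformation (hodd : Odd d) {m : ℕ}
    (hm : d * m = (d + 1) * (3 * d.choose 4)) :
    HasPureStokesMultiplicity (monomialDeformation d) m := by
  refine hasPureStokesMultiplicity_of_induced hodd hm (θ := id)
    (L := ContinuousLinearMap.id ℂ _) analyticAt_id rfl (fun v => by simp) ?_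
  filter_upwards [self_mem_nhdsWithin] with r hr
  filter_upwards [eventually_norm_lt_of_criticalDeriv_eq_zero hr] with s hs
  exact mem_pureStokesLocus_iff (g := id) (fun _ _ => rfl) (fun _ _ => differentiableAt_id)
    (fun w _ => by simp) fun x hx => ⟨x, mem_ball_zero_iff.2 (hs x hx), rfl⟩

/-- A holomorphic function close to the identity on a disc is locally biholomorphic on a
smaller disc, the image of which contains a neighbourhood of the origin. -/
theorem deriv_ne_zero_and_surj_of_near_id {g : ℂ → ℂ} {R r ε : ℝ} (hr : 0 < r) (hrR : r < R)
    (hg : DifferentiableOn ℂ g (Metric.ball 0 R)) (hε1 : ε < (R - r) / 2) (hε2 : ε < r / 8)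
    (hgε : ∀ w ∈ Metric.ball (0 : ℂ) R, ‖g w - w‖ ≤ ε) :
    (∀ w ∈ Metric.ball (0 : ℂ) r, deriv g w ≠ 0) ∧
    ∀ x : ℂ, ‖x‖ < r / 8 → ∃ w ∈ Metric.ball (0 : ℂ) r, g w = x := by
  constructor
  · intro w hw h0
    have hρ : 0 < (R - r) / 2 := by linarith
    have hsub : Metric.closedBall w ((R - r) / 2) ⊆ Metric.ball 0 R := by
      intro y hy
      rw [mem_ball_zero_iff] at hw ⊢
      have h1 : ‖y - w‖ ≤ (R - r) / 2 := mem_closedBall_iff_norm.1 hy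
      have h2 : ‖y‖ ≤ ‖y - w‖ + ‖w‖ := by simpa using norm_add_le (y - w) w
      linarith
    have hd : DiffContOnCl ℂ (fun y => g y - y) (Metric.ball w ((R - r) / 2)) :=
      ((hg.sub differentiableOn_id).mono hsub).diffContOnCl_ball subset_rfl
    have h1 := Complex.norm_deriv_le_of_forall_mem_sphere_norm_le hρ hd
      (fun y hy => hgε y (hsub (Metric.sphere_subset_closedBall hy)))
    have hgw : DifferentiableAt ℂ g w := hg.differentiableAt
      (Metric.isOpen_ball.mem_nhds (hsub (Metric.mem_closedBall_self hρ.le)))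
    have h2 : deriv (fun y => g y - y) w = -1 := by
      rw [deriv_fun_sub hgw differentiableAt_fun_id, h0]; simp
    rw [h2, norm_neg, norm_one, le_div_iff₀ hρ] at h1
    linarith
  · intro x hx
    have hsub : Metric.closedBall (0 : ℂ) (r / 2) ⊆ Metric.ball 0 R :=
      Metric.closedBall_subset_ball (by linarith)
    obtain ⟨w, hw, hw0⟩ := exists_zero_of_norm_lt_on_sphere (φ := fun w => g w - x)
      (ρ := r / 2) (m := r / 4) (by linarith)
      (((hg.sub (differentiableOn_const x)).mono hsub).diffContOnCl_ball subset_rfl)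
      (by
        have h1 := hgε 0 (Metric.mem_ball_self (hr.trans hrR))
        rw [sub_zero] at h1
        have h2 := norm_sub_le (g 0) x
        linarith)
      (fun z hz => by
        have h1 := hgε z (hsub (Metric.sphere_subset_closedBall hz))
        have h2 : ‖z‖ = r / 2 := mem_sphere_zero_iff_norm.1 hz
        have h3 : ‖z‖ ≤ ‖g z - x‖ + ‖g z - z‖ + ‖x‖ := by
          have : z = (g z - x) - (g z - z) + x := by ring
          calc ‖z‖ = ‖(g z - x) - (g z - z) + x‖ := by rw [← this]
            _ ≤ ‖(g z - x) - (g z - z)‖ + ‖x‖ := norm_add_le _ _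
            _ ≤ _ := by gcongr; exact norm_sub_le _ _
        linarith)
    exact ⟨w, Metric.ball_subset_ball (by linarith) hw, sub_eq_zero.1 hw0⟩

theorem eventually_mem_pureStokesLocus_iff {F : ℂ × (Fin k → ℂ) → ℂ} {R r : ℝ} (hr : 0 < r)
    (hrR : r < R) {g : (Fin k → ℂ) → discAlgebra} {θ : (Fin k → ℂ) → (Fin d → ℂ)}
    (hg : ContinuousAt g 0) (hg0 : g 0 = (R : ℂ) • discCoord)
    (hθ : ContinuousAt θ 0) (hθ0 : θ 0 = 0)
    (hF : ∀ᶠ s in 𝓝 0, ∀ z : closedUnitDisc,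
      F ((R : ℂ) * z, s) = monomialDeformation d ((g s).1 z, θ s)) :
    ∀ᶠ s in 𝓝 0, s ∈ pureStokesLocus F r ↔ θ s ∈ stokesLocus d := by
  have hR : 0 < R := hr.trans hrR
  have hRC : (R : ℂ) ≠ 0 := by exact_mod_cast hR.ne'
  have hθt : Tendsto θ (𝓝 0) (𝓝 0) := by simpa only [hθ0] using hθ.tendsto
  obtain ⟨ε, hε, hε1, hε2⟩ : ∃ ε > 0, ε < (R - r) / 2 ∧ ε < r / 8 := by
    obtain ⟨ε, h1, h2⟩ := exists_between
      (lt_min (by linarith : 0 < (R - r) / 2) (by linarith : 0 < r / 8))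
    exact ⟨ε, h1, lt_min_iff.1 h2⟩
  have hgt : ∀ᶠ s in 𝓝 0, ‖g s - (R : ℂ) • discCoord‖ < ε := by
    have := hg.tendsto
    rw [hg0, tendsto_iff_norm_sub_tendsto_zero] at this
    exact this.eventually_lt_const hε
  filter_upwards [hF, hgt, hθt.eventually
    (eventually_norm_lt_of_criticalDeriv_eq_zero (by linarith : 0 < r / 8))] with s h1 h2 h3
  have hball : ∀ w ∈ Metric.ball (0 : ℂ) R, w / R ∈ Metric.ball (0 : ℂ) 1 := by
    intro w hw
    rw [mem_ball_zero_iff] at hw ⊢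
    rw [norm_div, Complex.norm_real, Real.norm_of_nonneg hR.le, div_lt_one hR]
    exact hw
  have hdiff : DifferentiableOn ℂ (fun w => discExtend (g s).1 (w / R)) (Metric.ball 0 R) :=
    DifferentiableOn.comp (g := discExtend (g s).1) (f := fun w : ℂ => w / R)
      (mem_discAlgebra_iff.1 (g s).2) (by fun_prop) hball
  have hnear : ∀ w ∈ Metric.ball (0 : ℂ) R, ‖discExtend (g s).1 (w / R) - w‖ ≤ ε := by
    intro w hw
    have hw' := Metric.ball_subset_closedBall (hball w hw)
    rw [discExtend_apply _ hw']
    have h4 := ContinuousMap.norm_coe_le_norm (g s - (R : ℂ) • discCoord).1 ⟨w / R, hw'⟩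
    have h5 : (g s - (R : ℂ) • discCoord).1 ⟨w / R, hw'⟩ = (g s).1 ⟨w / R, hw'⟩ - w := by
      change _ - (R : ℂ) * (w / R) = _
      rw [mul_div_cancel₀ _ hRC]
    rw [h5] at h4
    exact h4.trans h2.le
  obtain ⟨h4, h5⟩ := deriv_ne_zero_and_surj_of_near_id hr hrR hdiff hε1 hε2 hnear
  refine mem_pureStokesLocus_iff (g := fun w => discExtend (g s).1 (w / R)) (fun w hw => ?_)
    (fun w hw => hdiff.differentiableAt
      (Metric.isOpen_ball.mem_nhds (Metric.ball_subset_ball hrR.le hw))) h4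
    (fun x hx => h5 x (h3 x hx))
  have hw' := Metric.ball_subset_closedBall (hball w (Metric.ball_subset_ball hrR.le hw))
  rw [discExtend_apply _ hw', ← h1 ⟨w / R, hw'⟩, mul_div_cancel₀ _ hRC]

theorem isDeformation_monomialDeformation :
    IsDeformation (fun z : ℂ => z ^ (d + 1)) (monomialDeformation d) :=
  ⟨analyticAt_monomialDeformation d _, Eventually.of_forall fun z => by
    simp [monomialDeformation]⟩

theorem IsVersalDeformation.hasPureStokesMultiplicity (hodd : Odd d) {m : ℕ}
    (hm : d * m = (d + 1) * (3 * d.choose 4)) {F : ℂ × (Fin k → ℂ) → ℂ}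
    (hF : IsVersalDeformation (fun z : ℂ => z ^ (d + 1)) F) :
    HasPureStokesMultiplicity F m := by
  obtain ⟨R, ⟨g, θ, hg, hg0, hθ, hθ0, hFM⟩, hR⟩ :=
    (hF.isDeformation.exists_eq_monomialDeformation.and self_mem_nhdsWithin).exists
  have hR : 0 < R := hR
  obtain ⟨g', θ', hg', hθ', hθ'0, hg'0, hMF⟩ :=
    hF.versal d _ isDeformation_monomialDeformation
  have hid := eventually_comp_eq_id hR hg hg0 hθ.continuousAt hθ0 hFM hg' hθ'.continuousAt hθ'0
    hg'0 hMF
  have hL : (fderiv ℂ θ 0).comp (fderiv ℂ θ' 0) = ContinuousLinearMap.id ℂ (Fin d → ℂ) := by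
    have h1 : HasFDerivAt θ (fderiv ℂ θ 0) (θ' 0) := by
      rw [hθ'0]; exact hθ.differentiableAt.hasFDerivAt
    have h2 := h1.comp 0 hθ'.differentiableAt.hasFDerivAt
    exact (h2.congr_of_eventuallyEq (hid.mono fun _ h => h.symm)).unique (hasFDerivAt_id 0)
  refine hasPureStokesMultiplicity_of_induced hodd hm hθ hθ0 (L := fderiv ℂ θ' 0)
    (fun v => DFunLike.congr_fun hL v) ?_
  filter_upwards [self_mem_nhdsWithin, nhdsWithin_le_nhds (eventually_lt_nhds hR)] with r hr hrR
  exact eventually_mem_pureStokesLocus_iff hr hrR hg hg0 hθ.continuousAt hθ0 hFM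

end

theorem theorem3 (d : ℕ) (hd : Odd d) :
    ∃ m : ℕ, (m : ℚ) = ((d : ℚ) + 1) * ((d : ℚ) - 1) * ((d : ℚ) - 2) * ((d : ℚ) - 3) / 8 ∧
      HasPureStokesMultiplicity (monomialDeformation d) m ∧
      ∀ (k : ℕ) (F : ℂ × (Fin k → ℂ) → ℂ),
        IsVersalDeformation (fun z : ℂ => z ^ (d + 1)) F → HasPureStokesMultiplicity F m := by
  obtain ⟨m, hm, hmd⟩ : ∃ m : ℕ,
      (m : ℚ) = ((d : ℚ) + 1) * ((d : ℚ) - 1) * ((d : ℚ) - 2) * ((d : ℚ) - 3) / 8 ∧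
      d * m = (d + 1) * (3 * d.choose 4) := by
    obtain ⟨j, rfl⟩ := hd
    -- `d = 1` is separate since `d - 3` truncates; otherwise `d = 2 * i + 3`.
    rcases j with _ | i
    · exact ⟨0, by norm_num, by norm_num [Nat.choose]⟩
    · refine ⟨(i + 2) * (i + 1) * (2 * i + 1) * i, by push_cast; ring, ?_⟩
      have h := Nat.descFactorial_eq_factorial_mul_choose (2 * (i + 1) + 1) 4
      have h1 : 2 * (i + 1) + 1 - 1 = 2 * i + 2 := by omega
      have h2 : 2 * (i + 1) + 1 - 2 = 2 * i + 1 := by omega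
      have h3 : 2 * (i + 1) + 1 - 3 = 2 * i := by omega
      have h4 : Nat.factorial 4 = 24 := rfl
      simp only [Nat.descFactorial_succ, Nat.descFactorial_zero, Nat.sub_zero, h1, h2, h3, h4] at h
      nlinarith [h]
  exact ⟨m, hm, hasPureStokesMultiplicity_monomialDeformation hd hmd,
    fun k F hF => hF.hasPureStokesMultiplicity hd hmd⟩
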